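/- Let $A$ be a group. A skew morphism of $A$ is a permutation $\varphi$ of $A$ fixing the identity element for which there is a function $\pi\colon A\to\mathbb{Z}$ (the power function of $\varphi$, whose values are uniquely determined modulo the order $|\varphi|$ of the permutation $\varphi$) such that $\varphi(ab)=\varphi(a)\,\varphi^{\pi(a)}(b)$ for all $a,b\in A$. A skew morphism $\varphi$ is smooth if $\pi(\varphi(a))\equiv\pi(a)\pmod{|\varphi|}$ for all $a\in A$. Theorem. Let $n\ge 1$ be an integer. Every skew morphism of the cyclic group $\mathbb{Z}_n$ of order $n$ is smooth if and only if $n=2^e n_1$ for some integer $e$ with $0\le e\le 4$ and some odd square-free positive integer $n_1$. -/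

import Mathlib

/-- `pw` is a power function of the permutation `φ` of the group `A`:
`φ (a b) = φ(a) φ^{pw(a)}(b)` for all `a, b`. -/
def IsPowerFunction {A : Type*} [Group A] (φ : Equiv.Perm A) (pw : A → ℤ) : Prop :=
  ∀ a b : A, φ (a * b) = φ a * (φ ^ pw a) b

/-- A skew morphism of `A` is a permutation of `A` that fixes the identity element and
has a power function. -/
def IsSkewMorphism {A : Type*} [Group A] (φ : Equiv.Perm A) : Prop :=
  φ 1 = 1 ∧ ∃ pw : A → ℤ, IsPowerFunction φ pw

/-- The values of a power function are determined modulo the order of `φ`. -/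
theorem IsPowerFunction.modEq {A : Type*} [Group A] {φ : Equiv.Perm A} {p q : A → ℤ}
    (hp : IsPowerFunction φ p) (hq : IsPowerFunction φ q) (a : A) :
    p a ≡ q a [ZMOD (orderOf φ : ℤ)] := by
  rw [← zpow_eq_zpow_iff_modEq]
  ext b
  exact mul_left_cancel ((hp a b).symm.trans (hq a b))

/-- A skew morphism `φ` is smooth if its power function, which is unique modulo the order
of `φ`, is constant modulo that order on the orbits of `φ`. -/
def IsSmoothSkewMorphism {A : Type*} [Group A] (φ : Equiv.Perm A) : Prop :=
  IsSkewMorphism φ ∧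
    ∀ pw : A → ℤ, IsPowerFunction φ pw → ∀ a : A, pw (φ a) ≡ pw a [ZMOD (orderOf φ : ℤ)]

/-!
A skew morphism `φ` of a cyclic group `A` generates, together with the translations, a group `G`
of permutations of `A`. It is the product of two cyclic subgroups, `⟨σ⟩` (the translations) and
`⟨φ⟩`, which meet trivially, and `⟨φ⟩` is core-free because it fixes a point. Let `K` be the
normal core of `⟨σ⟩` and `X` the intersection of `⟨σ⟩` with the smallest normal subgroup that
contains `φ` and `K`. The power function is constant on the cosets of `K`, and
`φ(a) - a` lies in `X`, so `φ` is smooth as soon as `X ≤ K`. This is proved by induction on the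
order of `G` (`IsCyclicFactorization.defect_le_ker`).

Since `⟨φ⟩` is core-free, a double coset count gives `|⟨φ⟩| < |⟨σ⟩|`, and so the power function
is not injective and `K ≠ 1`. Induction applies to the quotient by the normal core `M` of
`K⟨φ⟩` and shows that `XM` is normal in `G`. Suppose that `X/K` has an element of prime order `p`.
As `φ` centralises `M/K`, so do all elements of `X`, and this leads
(`exists_orderOf_eq_prime`) to an element `ε ∈ ⟨φ⟩` of order `p` which generates a normal
subgroup modulo the `p`-part of `K`. Since `⟨φ⟩` is core-free, `p` divides `|K|`, hence
`p ^ 2` divides `|A|`; so `p = 2`.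

At the prime `2`, the Sylow subgroups of `⟨σ⟩` and `⟨φ⟩` form together a Sylow subgroup `T` of
`G`. The involution `ε` is not central in `T`, so the factorisation of `T` is again core-free. If
`T ≠ G`, it is smooth by induction, and elements of odd order act trivially on the
cyclic `2`-groups involved, so that smoothness passes from `T` to `G`
(`defect_le_ker_of_sylow`, `defect_le_ker_of_conj_mem`). If `G` is a `2`-group, then
`|⟨φ⟩| ≤ |X| ≤ |A| / 2`, and the power function has odd values that separate the cosets of `K`,
whence `|A : K| ≤ |⟨φ⟩| / 2`. For `|A| ≤ 16` the only possibility is `|A| = 16`, `|⟨φ⟩| = 8`,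
`|K| = 4`, and it is excluded by computing with generators (`defect_le_ker_of_isPGroup_two`).

Conversely, if `h ^ 2 = 0` and `4 h ≠ 0` in `ℤ/n`, then `x ↦ -x + h (x + x ^ 2)` is a skew
morphism that is not smooth. Such an `h` exists if `n` is divisible by `64` or by the square of an
odd prime. The remaining case `n = 32 m` with `m` odd is reduced to `n = 32`, where an explicit
skew morphism is given.
-/

open Subgroup

universe u

/-! ### Elements of finite order -/

theorem mem_zpowers_of_orderOf_dvd {G : Type*} [Group G] [Finite G] {h x y : G}
    (hx : x ∈ zpowers h) (hy : y ∈ zpowers h) (hd : orderOf x ∣ orderOf y) : x ∈ zpowers y := by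
  classical
  have := Fintype.ofFinite (zpowers h)
  let x' : zpowers h := ⟨x, hx⟩
  let y' : zpowers h := ⟨y, hy⟩
  let S : Finset (zpowers h) := Finset.univ.filter fun z => z ^ orderOf y = 1
  let T : Finset (zpowers h) := Finset.univ.filter fun z => z ∈ zpowers y'
  have hS : S.card ≤ orderOf y := IsCyclic.card_pow_eq_one_le (orderOf_pos y)
  have hT : T.card = orderOf y := by
    have h1 : Nat.card (zpowers y') = orderOf y' := Nat.card_zpowers y'
    rw [Subgroup.orderOf_mk] at h1
    rw [← h1, Nat.card_eq_fintype_card, Fintype.card_subtype]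
  have hTS : T ⊆ S := by
    intro z hz
    simp only [T, S, Finset.mem_filter, Finset.mem_univ, true_and] at hz ⊢
    obtain ⟨i, rfl⟩ := hz
    have : y' ^ orderOf y = 1 := by
      apply Subtype.ext; simp [y', pow_orderOf_eq_one]
    simp only [← zpow_natCast, ← zpow_mul]
    rw [mul_comm, zpow_mul, zpow_natCast, this, one_zpow]
  have hEq : T = S := Finset.eq_of_subset_of_card_le hTS (by omega)
  have hxS : x' ∈ S := by
    simp only [S, Finset.mem_filter, Finset.mem_univ, true_and]
    apply Subtype.ext
    simpa [x'] using orderOf_dvd_iff_pow_eq_one.mp hd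
  rw [← hEq] at hxS
  simp only [T, Finset.mem_filter, Finset.mem_univ, true_and] at hxS
  obtain ⟨i, hi⟩ := hxS
  exact ⟨i, by simpa [x', y'] using congrArg Subtype.val hi⟩

theorem orderOf_conj_eq {G : Type*} [Group G] (g x : G) :
    orderOf (g * x * g⁻¹) = orderOf x := by
  simpa using orderOf_injective (MulAut.conj g).toMonoidHom (MulAut.conj g).injective x

/-- A finite cyclic group has one subgroup of each order, so a conjugate of `x` that lies in
a common cyclic subgroup with `x` is a power of `x`. -/
theorem conj_mem_zpowers {G : Type*} [Group G] [Finite G] {h x g : G}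
    (hx : x ∈ zpowers h) (hg : g * x * g⁻¹ ∈ zpowers h) : g * x * g⁻¹ ∈ zpowers x :=
  mem_zpowers_of_orderOf_dvd hg hx (orderOf_conj_eq g x).dvd

theorem eq_one_of_pow_coprime {G : Type*} [Group G] {x : G} {m n : ℕ} (h : m.Coprime n)
    (hm : x ^ m = 1) (hn : x ^ n = 1) : x = 1 := by
  have := Nat.dvd_gcd (orderOf_dvd_of_pow_eq_one hm) (orderOf_dvd_of_pow_eq_one hn)
  rw [h] at this
  exact orderOf_eq_one_iff.mp (Nat.dvd_one.mp this)

theorem mem_of_pow_coprime {G : Type*} [Group G] {H : Subgroup G} {x : G} {m n : ℕ}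
    (h : m.Coprime n) (hm : x ^ m ∈ H) (hn : x ^ n ∈ H) : x ∈ H := by
  have hb := Nat.gcd_eq_gcd_ab m n
  rw [h] at hb
  have : x = (x ^ m) ^ (m.gcdA n) * (x ^ n) ^ (m.gcdB n) := by
    rw [← zpow_natCast x m, ← zpow_natCast x n, ← zpow_mul, ← zpow_mul, ← zpow_add, ← hb]
    simp
  rw [this]
  exact H.mul_mem (H.zpow_mem hm _) (H.zpow_mem hn _)

theorem exists_primary_split {G : Type*} [Group G] [Finite G] (p : ℕ) [hp : Fact p.Prime]
    (g : G) : ∃ x ∈ zpowers g, ∃ y ∈ zpowers g, g = x * y ∧ (∃ k, x ^ p ^ k = 1) ∧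
      ∃ q, p.Coprime q ∧ y ^ q = 1 := by
  obtain ⟨k, q, hq, hn⟩ := Nat.exists_eq_pow_mul_and_not_dvd (orderOf_pos g).ne' p hp.out.ne_one
  have hpq : p.Coprime q := (Nat.Prime.coprime_iff_not_dvd hp.out).mpr hq
  have hb := Nat.gcd_eq_gcd_ab (p ^ k) q
  rw [(hpq.pow_left k : (p ^ k).gcd q = 1)] at hb
  have hg : g ^ (p ^ k * q) = 1 := by rw [← hn, pow_orderOf_eq_one]
  refine ⟨(g ^ q) ^ ((p ^ k).gcdB q), zpow_mem (pow_mem (mem_zpowers g) _) _,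
    (g ^ (p ^ k)) ^ ((p ^ k).gcdA q), zpow_mem (pow_mem (mem_zpowers g) _) _, ?_, ⟨k, ?_⟩,
    q, hpq, ?_⟩
  · rw [← zpow_natCast g q, ← zpow_natCast g (p ^ k), ← zpow_mul, ← zpow_mul, ← zpow_add,
      add_comm, ← hb]
    simp
  · rw [← zpow_natCast, zpow_comm, zpow_natCast, ← pow_mul, mul_comm, hg, one_zpow]
  · rw [← zpow_natCast, zpow_comm, zpow_natCast, ← pow_mul, hg, one_zpow]

theorem conj_pow_of_conj_eq_pow {G : Type*} [Group G] {g x : G} {s : ℕ}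
    (h : g * x * g⁻¹ = x ^ s) (i : ℕ) : g ^ i * x * (g ^ i)⁻¹ = x ^ s ^ i := by
  induction i with
  | zero => simp
  | succ i ih =>
    have : g ^ (i + 1) * x * (g ^ (i + 1))⁻¹ = g * (g ^ i * x * (g ^ i)⁻¹) * g⁻¹ := by
      rw [pow_succ']; group
    rw [this, ih, ← conj_pow, h, ← pow_mul, pow_succ, mul_comm]

/-- The automorphism group of a cyclic `2`-group is a `2`-group, so an element of odd order
that normalises a cyclic `2`-group centralises it. -/
theorem commute_of_odd_of_conj_mem {G : Type*} [Group G] [Finite G] {g x : G} {k q : ℕ}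
    (h : g * x * g⁻¹ ∈ zpowers x) (hx : x ^ 2 ^ k = 1) (hg : g ^ q = 1) (hq : Odd q) :
    Commute g x := by
  obtain ⟨f, -, hf⟩ := (Nat.dvd_prime_pow Nat.prime_two).mp (orderOf_dvd_of_pow_eq_one hx)
  obtain ⟨s, hs⟩ := mem_powers_iff_mem_zpowers.mpr h
  simp only at hs
  rcases Nat.eq_zero_or_pos f with rfl | hfpos
  · have : x = 1 := by rw [← orderOf_eq_one_iff, hf, pow_zero]
    rw [this]; exact Commute.one_right g
  have hsodd : Odd s := by
    rw [← Nat.not_even_iff_odd]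
    rintro ⟨t, ht⟩
    have h1 : orderOf (x ^ s) = orderOf x := by rw [hs, orderOf_conj_eq]
    have h2 : (x ^ s) ^ 2 ^ (f - 1) = 1 := by
      rw [← pow_mul, ht, ← two_mul, mul_comm 2 t, mul_assoc, ← pow_succ',
        Nat.sub_add_cancel hfpos, mul_comm, ← hf, pow_mul, pow_orderOf_eq_one, one_pow]
    have h3 := orderOf_dvd_of_pow_eq_one h2
    rw [h1, hf] at h3
    have := (Nat.pow_dvd_pow_iff_le_right (by norm_num : 1 < 2)).mp h3
    omega
  have hmod : x ^ s ^ 2 ^ f = x := by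
    have h1 : ((2 : ℕ) : ℤ) ∣ (s : ℤ) - 1 := by
      obtain ⟨t, ht⟩ := hsodd
      exact ⟨t, by rw [ht]; push_cast; ring⟩
    have h2 := dvd_sub_pow_of_dvd_sub h1 f
    rw [one_pow] at h2
    have h3 : ((2 ^ f : ℕ) : ℤ) ∣ ((s ^ 2 ^ f : ℕ) : ℤ) - (1 : ℕ) := by
      refine dvd_trans ?_ (by push_cast; exact h2)
      push_cast
      exact pow_dvd_pow 2 (Nat.le_succ f)
    have h4 : 1 ≡ s ^ 2 ^ f [MOD orderOf x] := by
      rw [hf]; exact (Nat.modEq_iff_dvd).mpr h3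
    have h5 := pow_eq_pow_iff_modEq.mpr h4
    rw [← h5, pow_one]
  have hc := conj_pow_of_conj_eq_pow hs.symm (2 ^ f)
  rw [hmod] at hc
  have h1 : g ^ 2 ^ f ∈ centralizer {x} := by
    rw [mem_centralizer_singleton_iff]
    exact mul_inv_eq_iff_eq_mul.mp hc
  have h2 : g ^ q ∈ centralizer {x} := by rw [hg]; exact one_mem _
  have := mem_of_pow_coprime ((Nat.coprime_two_left.mpr hq).pow_left f) h1 h2
  exact mem_centralizer_singleton_iff.mp this

/-! ### Factorisations into two cyclic subgroups -/

/-- `G` is the product of the cyclic subgroups `⟨σ⟩` and `⟨φ⟩`, which intersect trivially, and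
`⟨φ⟩` contains no nontrivial normal subgroup of `G`.  This is the situation of a skew morphism
`φ` of a cyclic group with generator `σ`, inside the group of permutations generated by `φ`
and the translations. -/
structure IsCyclicFactorization {G : Type u} [Group G] (σ φ : G) : Prop where
  compl : IsComplement' (zpowers σ) (zpowers φ)
  core : (zpowers φ).normalCore = ⊥

namespace IsCyclicFactorization

section

variable {G : Type u} [Group G] {σ φ : G}

theorem exists_mul (h : IsCyclicFactorization σ φ) (g : G) :
    ∃ a ∈ zpowers σ, ∃ c ∈ zpowers φ, g = a * c := by
  obtain ⟨x, hx, -⟩ := (isComplement'_def.mp h.compl).existsUnique g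
  exact ⟨x.1, x.1.2, x.2, x.2.2, hx.symm⟩

theorem eq_one (h : IsCyclicFactorization σ φ) {a : G} (ha : a ∈ zpowers σ)
    (hc : a ∈ zpowers φ) : a = 1 := by
  have := (disjoint_iff.mp h.compl.disjoint).le (mem_inf.mpr ⟨ha, hc⟩)
  simpa using this

theorem eq_and_eq (h : IsCyclicFactorization σ φ) {a a' c c' : G} (ha : a ∈ zpowers σ)
    (ha' : a' ∈ zpowers σ) (hc : c ∈ zpowers φ) (hc' : c' ∈ zpowers φ)
    (e : a * c = a' * c') : a = a' ∧ c = c' := by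
  have h1 : a'⁻¹ * a = c' * c⁻¹ := by
    rw [inv_mul_eq_iff_eq_mul, ← mul_assoc, ← e]; group
  have h2 : a'⁻¹ * a = 1 := h.eq_one (mul_mem (inv_mem ha') ha)
    (h1 ▸ mul_mem hc' (inv_mem hc))
  have h3 : a = a' := (inv_mul_eq_one.mp h2).symm
  subst h3
  exact ⟨rfl, mul_left_cancel e⟩

theorem conj_mem_of_mem_zpowers {G : Type*} [Group G] [Finite G] {B : Subgroup G} {s g : G}
    (hs : ∀ x ∈ B, s * x * s⁻¹ ∈ B) (hg : g ∈ zpowers s) : ∀ x ∈ B, g * x * g⁻¹ ∈ B := by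
  obtain ⟨n, rfl⟩ := mem_powers_iff_mem_zpowers.mpr hg
  simp only
  clear hg
  induction n with
  | zero => simp
  | succ n ih =>
    intro x hx
    have : s ^ (n + 1) * x * (s ^ (n + 1))⁻¹ = s * (s ^ n * x * (s ^ n)⁻¹) * s⁻¹ := by
      rw [pow_succ']; group
    rw [this]
    exact hs _ (ih x hx)

theorem normal_of_conj_mem [Finite G] (h : IsCyclicFactorization σ φ) {B : Subgroup G}
    (hσ : ∀ x ∈ B, σ * x * σ⁻¹ ∈ B) (hφ : ∀ x ∈ B, φ * x * φ⁻¹ ∈ B) : B.Normal := by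
  refine ⟨fun x hx g => ?_⟩
  obtain ⟨a, ha, c, hc, rfl⟩ := h.exists_mul g
  have := conj_mem_of_mem_zpowers hσ ha _ (conj_mem_of_mem_zpowers hφ hc x hx)
  have e : a * c * x * (a * c)⁻¹ = a * (c * x * c⁻¹) * a⁻¹ := by group
  rw [e]; exact this

theorem conj_eq_of_mem_zpowers {s a b : G} (ha : a ∈ zpowers s) (hb : b ∈ zpowers s) :
    a * b * a⁻¹ = b := by
  obtain ⟨i, rfl⟩ := ha
  obtain ⟨j, rfl⟩ := hb
  simp only
  rw [← zpow_add, ← zpow_neg, ← zpow_add]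
  congr 1; ring

theorem mul_comm_of_mem_zpowers {s a b : G} (ha : a ∈ zpowers s) (hb : b ∈ zpowers s) :
    a * b = b * a :=
  mul_inv_eq_iff_eq_mul.mp (conj_eq_of_mem_zpowers ha hb)

theorem eq_one_of_normal (h : IsCyclicFactorization σ φ) {F : Subgroup G} (hF : F.Normal)
    (hle : F ≤ zpowers φ) {x : G} (hx : x ∈ F) : x = 1 := by
  have : F ≤ (zpowers φ).normalCore := normal_le_normalCore.mpr hle
  rw [h.core] at this
  simpa using this hx

/-- The elements of `⟨φ⟩` that `σ` conjugates into `⟨φ⟩` form a normal subgroup of `G`, hence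
there are none but `1`. -/
theorem eq_one_of_conj_mem [Finite G] (h : IsCyclicFactorization σ φ) {c : G}
    (hc : c ∈ zpowers φ) (hσ : σ * c * σ⁻¹ ∈ zpowers φ) : c = 1 := by
  have hN : (zpowers c).Normal := by
    refine h.normal_of_conj_mem ?_ ?_
    · rintro x ⟨i, rfl⟩
      simp only
      rw [← conj_zpow]
      exact zpow_mem (conj_mem_zpowers hc hσ) i
    · intro x hx
      rwa [conj_eq_of_mem_zpowers (mem_zpowers φ) (zpowers_le.mpr hc hx)]
  exact h.eq_one_of_normal hN (zpowers_le.mpr hc) (mem_zpowers c)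

/-- The elements of `⟨σ⟩` that `φ` conjugates into `⟨σ⟩` (the kernel of the power function)
form the normal core of `⟨σ⟩`. -/
theorem mem_normalCore_of_conj_mem [Finite G] (h : IsCyclicFactorization σ φ) {a : G}
    (ha : a ∈ zpowers σ) (hφ : φ * a * φ⁻¹ ∈ zpowers σ) : a ∈ (zpowers σ).normalCore := by
  have hN : (zpowers a).Normal := by
    refine h.normal_of_conj_mem ?_ ?_
    · intro x hx
      rwa [conj_eq_of_mem_zpowers (mem_zpowers σ) (zpowers_le.mpr ha hx)]
    · rintro x ⟨i, rfl⟩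
      simp only
      rw [← conj_zpow]
      exact zpow_mem (conj_mem_zpowers ha hφ) i
  exact normal_le_normalCore.mpr (zpowers_le.mpr ha) (mem_zpowers a)

theorem mul_conj_injective [Finite G] (h : IsCyclicFactorization σ φ) :
    Function.Injective fun x : zpowers φ × zpowers φ => (x.1 : G) * σ * x.2 := by
  rintro ⟨⟨a, ha⟩, ⟨b, hb⟩⟩ ⟨⟨c, hc⟩, ⟨d, hd⟩⟩ e
  simp only at e
  have h1 : σ * (d * b⁻¹) * σ⁻¹ = c⁻¹ * a := by
    rw [eq_inv_mul_iff_mul_eq]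
    calc c * (σ * (d * b⁻¹) * σ⁻¹) = (c * σ * d) * b⁻¹ * σ⁻¹ := by group
      _ = a := by rw [← e]; group
  have h2 := h.eq_one_of_conj_mem (mul_mem hd (inv_mem hb)) (h1 ▸ mul_mem (inv_mem hc) ha)
  have hdb : d = b := mul_inv_eq_one.mp h2
  subst hdb
  have : a = c := by simpa using e
  simp [this]

theorem card_lt_card [Finite G] (h : IsCyclicFactorization σ φ) (hσ : σ ≠ 1) :
    Nat.card (zpowers φ) < Nat.card (zpowers σ) := by
  by_contra! hle
  have hc := h.compl.card_mul_card
  have hcard : Nat.card G ≤ Nat.card (zpowers φ × zpowers φ) := by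
    rw [Nat.card_prod, ← hc]
    exact Nat.mul_le_mul_right _ hle
  have hbij := (Function.Injective.bijective_of_nat_card_le h.mul_conj_injective hcard)
  obtain ⟨⟨⟨c, hc⟩, ⟨d, hd⟩⟩, e⟩ := hbij.2 1
  simp only at e
  have : σ = c⁻¹ * d⁻¹ := by
    rw [eq_inv_mul_iff_mul_eq, eq_inv_iff_mul_eq_one]; exact e
  exact hσ (h.eq_one (mem_zpowers σ) (this ▸ mul_mem (inv_mem hc) (inv_mem hd)))

theorem exists_mul' (h : IsCyclicFactorization σ φ) (g : G) :
    ∃ c ∈ zpowers φ, ∃ a ∈ zpowers σ, g = c * a := by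
  obtain ⟨a, ha, c, hc, e⟩ := h.exists_mul g⁻¹
  exact ⟨c⁻¹, inv_mem hc, a⁻¹, inv_mem ha, by rw [← mul_inv_rev, ← e, inv_inv]⟩

/-- Writing `φ s = s' c` with `s' ∈ ⟨σ⟩` and `c ∈ ⟨φ⟩`, the element `c` (the value of the power
function) determines `s` modulo the normal core of `⟨σ⟩`. -/
theorem mul_inv_mem_normalCore [Finite G] (h : IsCyclicFactorization σ φ) {s s' t t' c : G}
    (hs : s ∈ zpowers σ) (hs' : s' ∈ zpowers σ) (ht : t ∈ zpowers σ) (ht' : t' ∈ zpowers σ)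
    (e1 : φ * s = s' * c) (e2 : φ * t = t' * c) : s * t⁻¹ ∈ (zpowers σ).normalCore := by
  refine h.mem_normalCore_of_conj_mem (mul_mem hs (inv_mem ht)) ?_
  have : φ * (s * t⁻¹) * φ⁻¹ = s' * t'⁻¹ := by
    calc φ * (s * t⁻¹) * φ⁻¹ = (φ * s) * (φ * t)⁻¹ := by group
      _ = s' * t'⁻¹ := by rw [e1, e2]; group
  rw [this]
  exact mul_mem hs' (inv_mem ht')

theorem normalCore_ne_bot [Finite G] (h : IsCyclicFactorization σ φ) (hσ : σ ≠ 1) :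
    (zpowers σ).normalCore ≠ ⊥ := by
  intro hK
  refine (h.card_lt_card hσ).not_ge ?_
  choose f hf g hg e using h.exists_mul
  refine Nat.card_le_card_of_injective
    (fun s : zpowers σ => (⟨g (φ * s), hg _⟩ : zpowers φ)) ?_
  rintro ⟨s, hs⟩ ⟨t, ht⟩ hst
  have hst : g (φ * s) = g (φ * t) := congrArg Subtype.val hst
  have := h.mul_inv_mem_normalCore hs (hf _) ht (hf _) (e (φ * s))
    (by rw [hst]; exact e (φ * t))
  rw [hK, mem_bot] at this
  exact Subtype.ext (mul_inv_eq_one.mp this)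

end

/-! ### The kernel, the radical and the defect -/

section

variable {G : Type u} [Group G]

/-- The normal core of `⟨σ⟩`; it corresponds to the kernel of the power function. -/
abbrev ker (σ : G) : Subgroup G := (zpowers σ).normalCore

/-- The largest normal subgroup inside `ker σ · ⟨φ⟩`.  Factoring it out gives again a
factorisation with core-free second factor. -/
abbrev rad (σ φ : G) : Subgroup G := (ker σ ⊔ zpowers φ).normalCore

/-- The smallest normal subgroup that contains `φ` and `ker σ`. -/
abbrev cl (σ φ : G) : Subgroup G := normalClosure (zpowers φ : Set G) ⊔ ker σ

/-- The elements of `⟨σ⟩` in `cl σ φ`.  For a skew morphism they include the differences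
`φ(a) - a`, so the skew morphism is smooth when the defect is contained in `ker σ`. -/
abbrev defect (σ φ : G) : Subgroup G := zpowers σ ⊓ cl σ φ

variable {σ φ : G}

theorem ker_le_rad : ker σ ≤ rad σ φ := normal_le_normalCore.mpr le_sup_left

theorem zpowers_le_cl : zpowers φ ≤ cl σ φ := fun _ hx => mem_sup_left (subset_normalClosure hx)

theorem ker_le_cl : ker σ ≤ cl σ φ := le_sup_right

theorem rad_le_cl : rad σ φ ≤ cl σ φ :=
  (normalCore_le _).trans (sup_le ker_le_cl zpowers_le_cl)

theorem ker_le_defect : ker σ ≤ defect σ φ := le_inf (normalCore_le _) ker_le_cl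

theorem exists_mul_of_mem_rad {m : G} (hm : m ∈ rad σ φ) :
    ∃ k ∈ ker σ, ∃ d ∈ zpowers φ, d ∈ rad σ φ ∧ m = k * d := by
  obtain ⟨k, hk, d, hd, e⟩ := mem_sup_of_normal_left.mp (normalCore_le _ hm)
  refine ⟨k, hk, d, hd, ?_, e.symm⟩
  have : d = k⁻¹ * m := by rw [← e]; group
  rw [this]
  exact mul_mem (inv_mem (ker_le_rad hk)) hm

theorem mem_ker_of_mem_sup (h : IsCyclicFactorization σ φ) {a : G} (ha : a ∈ zpowers σ)
    (hs : a ∈ ker σ ⊔ zpowers φ) : a ∈ ker σ := by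
  obtain ⟨k, hk, d, hd, e⟩ := mem_sup_of_normal_left.mp hs
  have : a = k := (h.eq_and_eq ha (normalCore_le _ hk) (one_mem _) hd (by rw [e, mul_one])).1
  rwa [this]

theorem mem_ker_of_mem_rad (h : IsCyclicFactorization σ φ) {a : G} (ha : a ∈ zpowers σ)
    (hs : a ∈ rad σ φ) : a ∈ ker σ := h.mem_ker_of_mem_sup ha (normalCore_le _ hs)

theorem exists_mul_of_mem_cl (h : IsCyclicFactorization σ φ) {n : G} (hn : n ∈ cl σ φ) :
    ∃ x ∈ defect σ φ, ∃ c ∈ zpowers φ, n = x * c := by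
  obtain ⟨a, ha, c, hc, rfl⟩ := h.exists_mul n
  refine ⟨a, ⟨ha, ?_⟩, c, hc, rfl⟩
  simpa using mul_mem hn (inv_mem (zpowers_le_cl (σ := σ) hc))

/-- `rad σ φ / ker σ` is an image of a subgroup of `⟨φ⟩`, so `φ` centralises it, and with `φ`
the whole normal closure of `φ`. -/
theorem commutator_mem_ker {g m : G} (hg : g ∈ cl σ φ) (hm : m ∈ rad σ φ) :
    g * m * g⁻¹ * m⁻¹ ∈ ker σ := by
  let f := QuotientGroup.mk' (ker σ)
  have hN : ((rad σ φ).map f).Normal := Normal.map inferInstance f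
    (QuotientGroup.mk'_surjective _)
  let Z : Subgroup G := (centralizer (((rad σ φ).map f : Subgroup _) : Set (G ⧸ ker σ))).comap f
  have hZ : Z.Normal := inferInstance
  have hφ : zpowers φ ≤ Z := by
    intro c hc
    simp only [Z, mem_comap, mem_centralizer_iff]
    rintro _ ⟨m, hm, rfl⟩
    obtain ⟨k, hk, d, hd, -, rfl⟩ := exists_mul_of_mem_rad hm
    have hk1 : f k = 1 := (QuotientGroup.eq_one_iff k).mpr hk
    rw [map_mul, hk1, one_mul, ← map_mul, ← map_mul, mul_comm_of_mem_zpowers hd hc]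
  have hK : ker σ ≤ Z := by
    intro k hk
    have hk1 : f k = 1 := (QuotientGroup.eq_one_iff k).mpr hk
    simp only [Z, mem_comap, hk1, one_mem]
  have hcl : cl σ φ ≤ Z := sup_le (normalClosure_le_normal hφ) hK
  have h1 := mem_centralizer_iff.mp (hcl hg) (f m) (mem_map_of_mem f hm)
  rw [← QuotientGroup.eq_one_iff]
  change f (g * m * g⁻¹ * m⁻¹) = 1
  rw [map_mul, map_mul, map_mul, map_inv, map_inv, ← h1]
  group

theorem quotient (h : IsCyclicFactorization σ φ) :
    IsCyclicFactorization (QuotientGroup.mk' (rad σ φ) σ) (QuotientGroup.mk' (rad σ φ) φ) := by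
  set f := QuotientGroup.mk' (rad σ φ)
  constructor
  · apply isComplement'_of_disjoint_and_mul_eq_univ
    · rw [disjoint_def]
      intro x hx hx'
      rw [← MonoidHom.map_zpowers] at hx hx'
      obtain ⟨a, ha, rfl⟩ := hx
      obtain ⟨c, hc, e⟩ := hx'
      have h1 : c⁻¹ * a ∈ rad σ φ := QuotientGroup.eq.mp e
      have h2 : a ∈ ker σ ⊔ zpowers φ := by
        have := mul_mem (mem_sup_right hc) (normalCore_le _ h1)
        simpa using this
      exact (QuotientGroup.eq_one_iff a).mpr (ker_le_rad (h.mem_ker_of_mem_sup ha h2))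
    · rw [Set.eq_univ_iff_forall]
      intro x
      obtain ⟨g, rfl⟩ := QuotientGroup.mk'_surjective _ x
      obtain ⟨a, ha, c, hc, rfl⟩ := h.exists_mul g
      refine Set.mem_mul.mpr ⟨f a, ?_, f c, ?_, (map_mul f a c).symm⟩
      · rw [← MonoidHom.map_zpowers]; exact mem_map_of_mem f ha
      · rw [← MonoidHom.map_zpowers]; exact mem_map_of_mem f hc
  · rw [eq_bot_iff]
    intro x hx
    have hx0 := normalCore_le _ hx
    rw [← MonoidHom.map_zpowers] at hx0
    obtain ⟨c, hc, rfl⟩ := hx0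
    refine mem_bot.mpr ((QuotientGroup.eq_one_iff c).mpr ?_)
    intro b
    have hb := hx (f b)
    rw [← map_mul, ← map_inv, ← map_mul, ← MonoidHom.map_zpowers] at hb
    obtain ⟨c', hc', e⟩ := hb
    have h1 : c'⁻¹ * (b * c * b⁻¹) ∈ rad σ φ := QuotientGroup.eq.mp e
    have := mul_mem (mem_sup_right (S := ker σ) hc') (normalCore_le _ h1)
    simpa [mul_assoc] using this

theorem normal_defect_sup_rad
    (hN : (zpowers (QuotientGroup.mk' (rad σ φ) σ) ⊓
      normalClosure (zpowers (QuotientGroup.mk' (rad σ φ) φ) : Set (G ⧸ rad σ φ))).Normal) :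
    (defect σ φ ⊔ rad σ φ).Normal := by
  set f := QuotientGroup.mk' (rad σ φ) with hf
  have hsurj : Function.Surjective f := QuotientGroup.mk'_surjective _
  have h1 : normalClosure (zpowers (f φ) : Set (G ⧸ rad σ φ)) =
      (normalClosure (zpowers φ : Set G)).map f := by
    rw [map_normalClosure _ f hsurj, ← MonoidHom.map_zpowers]; rfl
  rw [h1, ← MonoidHom.map_zpowers] at hN
  have h2 := hN.comap f
  rw [comap_inf, comap_map_eq, comap_map_eq, QuotientGroup.ker_mk'] at h2
  convert h2 using 1
  apply le_antisymm
  · refine sup_le (le_inf ((inf_le_left).trans le_sup_left) ?_) (le_inf le_sup_right le_sup_right)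
    exact inf_le_right.trans (sup_le le_sup_left (ker_le_rad.trans le_sup_right))
  · rintro v ⟨hv1, hv2⟩
    obtain ⟨a, ha, m, hm, rfl⟩ := mem_sup_of_normal_right.mp hv1
    have h3 : a * m ∈ cl σ φ := (sup_le le_sup_left rad_le_cl) hv2
    have h4 : a ∈ cl σ φ := by simpa using mul_mem h3 (inv_mem (rad_le_cl hm))
    exact mul_mem (mem_sup_left ⟨ha, h4⟩) (mem_sup_right hm)

theorem exists_mul_of_mem_defect_sup_rad {v : G} (hv : v ∈ defect σ φ ⊔ rad σ φ) :
    ∃ x ∈ defect σ φ, ∃ d ∈ zpowers φ, d ∈ rad σ φ ∧ v = x * d := by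
  obtain ⟨x, hx, m, hm, rfl⟩ := mem_sup_of_normal_right.mp hv
  obtain ⟨k, hk, d, hd, hdr, rfl⟩ := exists_mul_of_mem_rad hm
  exact ⟨x * k, mul_mem hx (ker_le_defect hk), d, hd, hdr, by group⟩

end

/-! ### Elements of prime order in the radical -/

/-- The order of `x` is a power of `p`. -/
def IsPElement {G : Type u} [Group G] (p : ℕ) (x : G) : Prop := ∃ k, x ^ p ^ k = 1

section

variable {G : Type u} [Group G] {p : ℕ}

theorem IsPElement.conj {x : G} (hx : IsPElement p x) (g : G) : IsPElement p (g * x * g⁻¹) := by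
  obtain ⟨k, hk⟩ := hx
  exact ⟨k, by rw [conj_pow, hk, mul_one, mul_inv_cancel]⟩

theorem IsPElement.mono {x : G} {k l : ℕ} (hx : x ^ p ^ k = 1) (h : k ≤ l) :
    x ^ p ^ l = 1 := by
  obtain ⟨j, rfl⟩ := Nat.exists_eq_add_of_le h
  rw [pow_add, pow_mul, hx, one_pow]

theorem IsPElement.mul {x y : G} (h : Commute x y) (hx : IsPElement p x)
    (hy : IsPElement p y) : IsPElement p (x * y) := by
  obtain ⟨k, hk⟩ := hx
  obtain ⟨l, hl⟩ := hy
  refine ⟨max k l, ?_⟩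
  rw [h.mul_pow, mono hk (le_max_left _ _), mono hl (le_max_right _ _), mul_one]

theorem IsPElement.one : IsPElement p (1 : G) := ⟨0, one_pow _⟩

theorem IsPElement.zpowers {x y : G} (hx : IsPElement p x) (hy : y ∈ zpowers x) :
    IsPElement p y := by
  obtain ⟨k, hk⟩ := hx
  obtain ⟨i, rfl⟩ := hy
  exact ⟨k, by simp only; rw [← zpow_natCast, zpow_comm, zpow_natCast, hk, one_zpow]⟩

variable {σ φ : G}

theorem exists_conj_eq_zpow_mul [Finite G]
    (hV : (defect σ φ ⊔ rad σ φ).Normal) {x : G} (hx : x ∈ defect σ φ) (g : G) :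
    ∃ i : ℤ, ∃ m ∈ rad σ φ, g * x * g⁻¹ = x ^ i * m := by
  set f := QuotientGroup.mk' (rad σ φ)
  have h1 := hV.conj_mem x (mem_sup_left hx) g
  obtain ⟨x', hx', m, hm, e⟩ := mem_sup_of_normal_right.mp h1
  have hm1 : f m = 1 := (QuotientGroup.eq_one_iff m).mpr hm
  have h2 : f g * f x * (f g)⁻¹ ∈ zpowers (f x) := by
    refine conj_mem_zpowers (h := f σ) ?_ ?_
    · rw [← MonoidHom.map_zpowers]; exact mem_map_of_mem f hx.1
    · rw [← map_mul, ← map_inv, ← map_mul, ← e, map_mul, hm1, mul_one, ← MonoidHom.map_zpowers]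
      exact mem_map_of_mem f hx'.1
  obtain ⟨i, hi⟩ := h2
  refine ⟨i, (x ^ i)⁻¹ * (g * x * g⁻¹), ?_, by group⟩
  apply QuotientGroup.eq.mp
  change f (x ^ i) = f (g * x * g⁻¹)
  rw [map_mul, map_mul, map_inv, map_zpow]; exact hi

variable {y : G}

theorem pow_mem_ker_of_mem_sup (hy : y ∈ zpowers σ) (hyp : y ^ p ∈ ker σ) {z : G}
    (hz : z ∈ zpowers y ⊔ ker σ) : z ^ p ∈ ker σ := by
  obtain ⟨u, ⟨i, rfl⟩, k, hk, rfl⟩ := mem_sup_of_normal_right.mp hz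
  have hc : Commute (y ^ i) k :=
    mul_comm_of_mem_zpowers (zpow_mem hy i) (normalCore_le _ hk)
  simp only
  rw [hc.mul_pow, ← zpow_natCast, zpow_comm, zpow_natCast]
  exact mul_mem (zpow_mem hyp i) (pow_mem hk p)

theorem sup_ker_le (hy : y ∈ zpowers σ) : zpowers y ⊔ ker σ ≤ zpowers σ :=
  sup_le (zpowers_le.mpr hy) (normalCore_le _)

theorem sup_ker_le_defect (hy : y ∈ defect σ φ) : zpowers y ⊔ ker σ ≤ defect σ φ :=
  sup_le (zpowers_le.mpr hy) ker_le_defect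

/-- If a product of `z ∈ ⟨σ⟩` and `e ∈ ⟨φ⟩`, commuting modulo `ker σ`, has its `n`-th power in
`ker σ`, and so has `z`, then `e ^ n = 1`. -/
theorem pow_eq_one_of_mul_pow_mem (h : IsCyclicFactorization σ φ) {z e : G}
    (hz : z ∈ defect σ φ) (he : e ∈ zpowers φ) (her : e ∈ rad σ φ) {n : ℕ}
    (hn : (z * e) ^ n ∈ zpowers σ ⊓ rad σ φ) : e ^ n = 1 := by
  set f := QuotientGroup.mk' (ker σ)
  have hc : Commute (f z) (f e) := by
    have h1 := commutator_mem_ker hz.2 her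
    have h2 : f (z * e * z⁻¹ * e⁻¹) = 1 := (QuotientGroup.eq_one_iff _).mpr h1
    rw [map_mul, map_mul, map_mul, map_inv, map_inv, mul_inv_eq_one, mul_inv_eq_iff_eq_mul] at h2
    exact h2
  have h1 : (z * e) ^ n ∈ ker σ := h.mem_ker_of_mem_rad hn.1 hn.2
  have h2 : f ((z * e) ^ n) = 1 := (QuotientGroup.eq_one_iff _).mpr h1
  rw [map_pow, map_mul, hc.mul_pow, ← map_pow, ← map_pow, ← map_mul] at h2
  have h3 : z ^ n * e ^ n ∈ ker σ := (QuotientGroup.eq_one_iff _).mp h2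
  have h4 : e ^ n = (z ^ n)⁻¹ * (z ^ n * e ^ n) := by group
  refine h.eq_one (h4 ▸ mul_mem (inv_mem (pow_mem hz.1 n)) (normalCore_le _ h3))
    (pow_mem he n)

variable [Finite G]

/-- Let `y` have order `p` modulo `ker σ`.  The product of `⟨y⟩ · ker σ` and the elements of
`⟨φ⟩` in the radical that centralise the `p'`-part of `ker σ` is normal in `G`; its
`p`-elements are products of `p`-elements of the two factors. -/
theorem exists_mul_of_isPElement (h : IsCyclicFactorization σ φ) [hp : Fact p.Prime]
    (hV : (defect σ φ ⊔ rad σ φ).Normal) (hy : y ∈ defect σ φ) (hyp : y ^ p ∈ ker σ)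
    {n : G} (hn : n ∈ zpowers y ⊔ rad σ φ)
    (hcomm : ∀ k ∈ ker σ, ∀ q, p.Coprime q → k ^ q = 1 → Commute n k)
    (hnp : IsPElement p n) (g : G) :
    ∃ z ∈ zpowers y ⊔ ker σ, IsPElement p z ∧ ∃ e ∈ zpowers φ, e ∈ rad σ φ ∧ IsPElement p e ∧
      (∀ k ∈ ker σ, ∀ q, p.Coprime q → k ^ q = 1 → Commute e k) ∧ g * n * g⁻¹ = z * e := by
  set n' := g * n * g⁻¹ with hn'
  have hnp' : IsPElement p n' := hnp.conj g
  have hcomm' : ∀ k ∈ ker σ, ∀ q, p.Coprime q → k ^ q = 1 → Commute n' k := by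
    intro k hk q hq hkq
    have h1 := hcomm (g⁻¹ * k * g) (by simpa using (inferInstance : (ker σ).Normal).conj_mem k hk g⁻¹) q hq
      (by have := conj_pow (a := g⁻¹) (b := k) (i := q)
          rw [inv_inv] at this
          rw [this, hkq]; group)
    have h2 : n * (g⁻¹ * k * g) = (g⁻¹ * k * g) * n := h1
    change n' * k = k * n'
    calc n' * k = g * (n * (g⁻¹ * k * g)) * g⁻¹ := by rw [hn']; group
      _ = k * n' := by rw [h2, hn']; group
  have hw : n' ∈ zpowers y ⊔ rad σ φ := by
    obtain ⟨u, ⟨i, rfl⟩, m, hm, e⟩ := mem_sup_of_normal_right.mp hn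
    obtain ⟨j, m', hm', e'⟩ := exists_conj_eq_zpow_mul hV hy g
    have : n' = (g * y * g⁻¹) ^ i * (g * m * g⁻¹) := by
      rw [hn', ← e, conj_zpow]; group
    rw [this, e']
    refine mul_mem (zpow_mem (mul_mem (mem_sup_left (zpow_mem (mem_zpowers y) j))
      (mem_sup_right hm')) i) (mem_sup_right ((inferInstance : (rad σ φ).Normal).conj_mem m hm g))
  obtain ⟨u, hu, m, hm, e1⟩ := mem_sup_of_normal_right.mp hw
  obtain ⟨k, hk, e, he, her, rfl⟩ := exists_mul_of_mem_rad hm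
  set z := u * k with hz
  have hzY : z ∈ zpowers y ⊔ ker σ := mul_mem (mem_sup_left hu) (mem_sup_right hk)
  have hYA := sup_ker_le hy.1
  have hYd := sup_ker_le_defect hy
  have e2 : n' = z * e := by rw [hz, ← e1]; group
  have hecomm : ∀ k ∈ ker σ, ∀ q, p.Coprime q → k ^ q = 1 → Commute e k := by
    intro k hk q hq hkq
    have h1 : e = z⁻¹ * n' := by rw [e2]; group
    have h2 : Commute z k := mul_comm_of_mem_zpowers (hYA hzY) (normalCore_le _ hk)
    rw [h1]
    exact h2.inv_left.mul_left (hcomm' k hk q hq hkq)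
  obtain ⟨a, ha, b, hb, e3, ⟨r, hr⟩, q, hq, hbq⟩ := exists_primary_split p z
  obtain ⟨t, ht⟩ := hnp'
  have haY : a ∈ zpowers y ⊔ ker σ := zpowers_le.mpr hzY ha
  have hbY : b ∈ zpowers y ⊔ ker σ := zpowers_le.mpr hzY hb
  have hbK : b ∈ ker σ := by
    refine mem_of_pow_coprime hq (pow_mem_ker_of_mem_sup hy.1 hyp hbY) ?_
    rw [hbq]; exact one_mem _
  have het : e ^ p ^ t = 1 := by
    refine h.pow_eq_one_of_mul_pow_mem (hYd hzY) he her ?_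
    rw [← e2, ht]; exact one_mem _
  -- `e` normalises the `p`-part of `⟨y⟩ · ker σ`, so `a * e` is a `p`-element.
  have hconj : ∀ w ∈ zpowers y ⊔ ker σ, e * w * e⁻¹ ∈ zpowers y ⊔ ker σ := by
    intro w hw
    have h1 := commutator_mem_ker (hYd hw).2 her
    have h2 : e * w * e⁻¹ = (w * e * w⁻¹ * e⁻¹)⁻¹ * w := by group
    rw [h2]
    exact mul_mem (mem_sup_right (inv_mem h1)) hw
  have hpow : ∀ N : ℕ, ∃ w ∈ zpowers y ⊔ ker σ, IsPElement p w ∧ (a * e) ^ N = w * e ^ N := by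
    intro N
    induction N with
    | zero => exact ⟨1, one_mem _, IsPElement.one, by simp⟩
    | succ N ih =>
      obtain ⟨w, hw, hwp, hwe⟩ := ih
      refine ⟨a * (e * w * e⁻¹), mul_mem haY (hconj w hw), ?_, ?_⟩
      · exact IsPElement.mul (mul_comm_of_mem_zpowers (hYA haY) (hYA (hconj w hw))) ⟨r, hr⟩
          (hwp.conj e)
      · rw [pow_succ', hwe, pow_succ']; group
  obtain ⟨w, hw, ⟨s, hs⟩, hwe⟩ := hpow (p ^ t)
  have hae : IsPElement p (a * e) := ⟨t + s, by rw [pow_add, pow_mul, hwe, het, mul_one, hs]⟩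
  have hbc : Commute (a * e) b := by
    refine Commute.mul_left (mul_comm_of_mem_zpowers (hYA haY) (hYA hbY)) ?_
    exact hecomm b hbK q hq hbq
  have e4 : n' = (a * e) * b := by
    rw [e2, e3, mul_assoc, mul_assoc, (hecomm b hbK q hq hbq).eq]
  obtain ⟨s', hs'⟩ := hae
  have hb1 : b = 1 := by
    refine eq_one_of_pow_coprime (hq.pow_left (max t s')) ?_ hbq
    have h1 : n' ^ p ^ (max t s') = 1 := IsPElement.mono ht (le_max_left _ _)
    rw [e4, hbc.mul_pow, IsPElement.mono hs' (le_max_right _ _), one_mul] at h1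
    exact h1
  refine ⟨a, haY, ⟨r, hr⟩, e, he, her, ⟨t, het⟩, hecomm, ?_⟩
  rw [e4, hb1, mul_one]

/-- If the defect is not contained in `ker σ` at the prime `p`, then `⟨φ⟩` has an element `ε`
of order `p` that generates a normal subgroup modulo the `p`-part of `ker σ`; as `⟨φ⟩` is
core-free, that `p`-part is nontrivial. -/
theorem exists_orderOf_eq_prime (h : IsCyclicFactorization σ φ) [hp : Fact p.Prime]
    (hV : (defect σ φ ⊔ rad σ φ).Normal) (hy : y ∈ defect σ φ) (hyK : y ∉ ker σ)
    (hyp : y ^ p ∈ ker σ) :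
    p ^ 2 ∣ Nat.card (zpowers σ) ∧ ∃ ε ∈ zpowers φ, ε ∈ rad σ φ ∧ orderOf ε = p ∧
      (∀ g, ∃ k ∈ ker σ, IsPElement p k ∧ ∃ e ∈ zpowers ε, g * ε * g⁻¹ = k * e) ∧
      (∀ g, ∀ z ∈ zpowers y ⊔ ker σ, IsPElement p z → ∃ z' ∈ zpowers y ⊔ ker σ,
        IsPElement p z' ∧ ∃ e ∈ zpowers ε, g * z * g⁻¹ = z' * e) := by
  have hYA := sup_ker_le hy.1
  have hYd := sup_ker_le_defect hy
  have hKn : (ker σ).Normal := inferInstance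
  have hcommA : ∀ z ∈ zpowers σ, ∀ k ∈ ker σ, ∀ q, p.Coprime q → k ^ q = 1 → Commute z k :=
    fun z hz k hk _ _ _ => mul_comm_of_mem_zpowers hz (normalCore_le _ hk)
  have hYrad : zpowers y ⊔ ker σ ≤ zpowers y ⊔ rad σ φ := sup_le_sup_left ker_le_rad _
  obtain ⟨a, ha, b, hb, hab, hap, q, hq, hbq⟩ := exists_primary_split p y
  have hyY : y ∈ zpowers y ⊔ ker σ := mem_sup_left (mem_zpowers y)
  have haY : a ∈ zpowers y ⊔ ker σ := zpowers_le.mpr hyY ha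
  have hbY : b ∈ zpowers y ⊔ ker σ := zpowers_le.mpr hyY hb
  have hbK : b ∈ ker σ := by
    refine mem_of_pow_coprime hq (pow_mem_ker_of_mem_sup hy.1 hyp hbY) ?_
    rw [hbq]; exact one_mem _
  have haK : a ∉ ker σ := fun ha' => hyK (hab ▸ mul_mem ha' hbK)
  obtain ⟨e, he, her, hep, hecomm, hne⟩ : ∃ e ∈ zpowers φ, e ∈ rad σ φ ∧ IsPElement p e ∧
      (∀ k ∈ ker σ, ∀ q, p.Coprime q → k ^ q = 1 → Commute e k) ∧ e ≠ 1 := by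
    by_contra! hcon
    refine haK fun g => ?_
    obtain ⟨z, hz, -, e, he, her, hep, hec, e1⟩ := h.exists_mul_of_isPElement hV hy hyp
      (hYrad haY) (hcommA a (hYA haY)) hap g
    rw [e1, hcon e he her hep hec, mul_one]
    exact hYA hz
  obtain ⟨ε, hεe, hεo⟩ : ∃ ε ∈ zpowers e, orderOf ε = p := by
    obtain ⟨k, hk⟩ := hep
    obtain ⟨f, -, hf⟩ := (Nat.dvd_prime_pow hp.out).mp (orderOf_dvd_of_pow_eq_one hk)
    have hf0 : f ≠ 0 := by
      rintro rfl
      exact hne (orderOf_eq_one_iff.mp (by rw [hf, pow_zero]))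
    refine ⟨e ^ p ^ (f - 1), pow_mem (mem_zpowers e) _, ?_⟩
    rw [orderOf_pow_of_dvd (pow_ne_zero _ hp.out.ne_zero)
      (by rw [hf]; exact pow_dvd_pow p (Nat.sub_le f 1)), hf,
      Nat.pow_div (Nat.sub_le f 1) hp.out.pos]
    have : f - (f - 1) = 1 := by omega
    rw [this, pow_one]
  have hεC : ε ∈ zpowers φ := zpowers_le.mpr he hεe
  have hεr : ε ∈ rad σ φ := zpowers_le.mpr her hεe
  have hεc : ∀ k ∈ ker σ, ∀ q, p.Coprime q → k ^ q = 1 → Commute ε k := by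
    intro k hk q hq hkq
    obtain ⟨i, rfl⟩ := hεe
    exact (hecomm k hk q hq hkq).zpow_left i
  have hε1 : ε ^ p = 1 := by rw [← hεo, pow_orderOf_eq_one]
  have hεp : IsPElement p ε := ⟨1, by rw [pow_one, hε1]⟩
  have hmem : ∀ c ∈ zpowers φ, c ^ p = 1 → c ∈ zpowers ε := fun c hc hc1 =>
    mem_zpowers_of_orderOf_dvd hc hεC (by rw [hεo]; exact orderOf_dvd_of_pow_eq_one hc1)
  have hε_conj : ∀ g, ∃ k ∈ ker σ, IsPElement p k ∧ ∃ e ∈ zpowers ε, g * ε * g⁻¹ = k * e := by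
    intro g
    obtain ⟨z, hz, hzp, e', he', her', -, -, e1⟩ := h.exists_mul_of_isPElement hV hy hyp
      (mem_sup_right hεr) hεc hεp g
    have h1 : g * ε * g⁻¹ ∈ rad σ φ := (inferInstance : (rad σ φ).Normal).conj_mem ε hεr g
    have h2 : z ∈ rad σ φ := by
      have : z = (g * ε * g⁻¹) * e'⁻¹ := by rw [e1]; group
      rw [this]; exact mul_mem h1 (inv_mem her')
    refine ⟨z, h.mem_ker_of_mem_rad (hYA hz) h2, hzp, e', hmem e' he' ?_, e1⟩
    refine h.pow_eq_one_of_mul_pow_mem (hYd hz) he' her' ?_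
    rw [← e1, conj_pow, hε1, mul_one, mul_inv_cancel]
    exact one_mem _
  refine ⟨?_, ε, hεC, hεr, hεo, hε_conj, ?_⟩
  · obtain ⟨k, hk, ⟨i, hi⟩, hk1⟩ : ∃ k ∈ ker σ, IsPElement p k ∧ k ≠ 1 := by
      by_contra! hcon
      have : ε ∈ (zpowers φ).normalCore := by
        intro g
        obtain ⟨k, hk, hkp, e', he', e1⟩ := hε_conj g
        rw [e1, hcon k hk hkp, one_mul]
        exact zpowers_le.mpr hεC he'
      rw [h.core, mem_bot] at this
      rw [this, orderOf_one] at hεo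
      exact hp.out.one_lt.ne hεo
    obtain ⟨r, hr⟩ := hap
    obtain ⟨s, -, hs⟩ := (Nat.dvd_prime_pow hp.out).mp (orderOf_dvd_of_pow_eq_one hr)
    obtain ⟨t, -, ht⟩ := (Nat.dvd_prime_pow hp.out).mp (orderOf_dvd_of_pow_eq_one hi)
    have ht0 : t ≠ 0 := by
      rintro rfl
      exact hk1 (orderOf_eq_one_iff.mp (by rw [ht, pow_zero]))
    have hs2 : 2 ≤ s := by
      by_contra! hs1
      refine haK (zpowers_le.mpr hk (mem_zpowers_of_orderOf_dvd (hYA haY) (normalCore_le _ hk) ?_))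
      rw [hs, ht]
      exact pow_dvd_pow p (by omega)
    refine (pow_dvd_pow p hs2).trans ?_
    rw [← hs]
    exact Subgroup.orderOf_dvd_natCard _ (hYA haY)
  · intro g z hz hzp
    obtain ⟨z', hz', hzp', e', he', her', -, -, e1⟩ := h.exists_mul_of_isPElement hV hy hyp
      (hYrad hz) (hcommA z (hYA hz)) hzp g
    refine ⟨z', hz', hzp', e', hmem e' he' ?_, e1⟩
    refine h.pow_eq_one_of_mul_pow_mem (hYd hz') he' her' ?_
    rw [← e1, conj_pow]
    have := hKn.conj_mem _ (pow_mem_ker_of_mem_sup hy.1 hyp hz) g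
    exact ⟨normalCore_le _ this, ker_le_rad this⟩

end

/-! ### Sylow subgroups of a product of two cyclic groups -/

section

variable {G : Type u} [Group G] [Finite G] {σ φ : G}

/-- A Sylow subgroup of `⟨σ⟩⟨φ⟩` can be chosen as the product of the Sylow subgroups of `⟨σ⟩`
and `⟨φ⟩`. -/
theorem exists_isPGroup_isComplement' (h : IsCyclicFactorization σ φ) (p : ℕ)
    [hp : Fact p.Prime] {x y u v : G} (hx : x ∈ zpowers σ) (hy : y ∈ zpowers σ)
    (hu : u ∈ zpowers φ) (hv : v ∈ zpowers φ) (hσ : σ = x * y) (hφ : φ = u * v)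
    (hxp : IsPElement p x) (hup : IsPElement p u) {q r : ℕ} (hq : p.Coprime q)
    (hr : p.Coprime r) (hyq : y ^ q = 1) (hvr : v ^ r = 1) :
    ∃ (T : Subgroup G) (hxT : x ∈ T) (huT : u ∈ T), IsPGroup p T ∧
      IsComplement' (zpowers (⟨x, hxT⟩ : T)) (zpowers (⟨u, huT⟩ : T)) := by
  have hpg : ∀ z : G, IsPElement p z → IsPGroup p (zpowers z) := by
    intro z hz
    rw [IsPGroup]
    rintro ⟨w, hw⟩
    obtain ⟨k, hk⟩ := hz.zpowers hw
    exact ⟨k, Subtype.ext hk⟩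
  obtain ⟨P, hP⟩ := (hpg x hxp).exists_le_sylow
  obtain ⟨Q, hQ⟩ := (hpg u hup).exists_le_sylow
  obtain ⟨g, rfl⟩ := MulAction.exists_smul_eq G P Q
  obtain ⟨c, hc, a, ha, rfl⟩ := h.exists_mul' g
  have hxT : x ∈ (a • P : Sylow p G) := by
    rw [← SetLike.mem_coe, Sylow.coe_smul, Set.mem_smul_set_iff_inv_smul_mem]
    have : (MulAut.conj a)⁻¹ • x = x := by
      rw [← map_inv]
      exact conj_eq_of_mem_zpowers (inv_mem ha) hx
    rw [this]
    exact hP (mem_zpowers x)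
  have huT : u ∈ (a • P : Sylow p G) := by
    have h1 : u ∈ ((c * a) • P : Sylow p G) := hQ (mem_zpowers u)
    rw [mul_smul, ← SetLike.mem_coe, Sylow.coe_smul, Set.mem_smul_set_iff_inv_smul_mem] at h1
    have : (MulAut.conj c)⁻¹ • u = u := by
      rw [← map_inv]
      exact conj_eq_of_mem_zpowers (inv_mem hc) hu
    rwa [this] at h1
  refine ⟨(a • P : Sylow p G), hxT, huT, (a • P : Sylow p G).isPGroup', ?_⟩
  have hcop : ∀ {s t : G} {n : ℕ}, IsPElement p s → p.Coprime n → t ^ n = 1 →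
      (orderOf s).Coprime (orderOf t) := by
    rintro s t n ⟨k, hk⟩ hn ht
    exact ((hn.pow_left k).coprime_dvd_left (orderOf_dvd_of_pow_eq_one hk)).coprime_dvd_right
      (orderOf_dvd_of_pow_eq_one ht)
  have h1 : orderOf σ = orderOf x * orderOf y := by
    rw [hσ]
    exact Commute.orderOf_mul_eq_mul_orderOf_of_coprime (mul_comm_of_mem_zpowers hx hy)
      (hcop hxp hq hyq)
  have h2 : orderOf φ = orderOf u * orderOf v := by
    rw [hφ]
    exact Commute.orderOf_mul_eq_mul_orderOf_of_coprime (mul_comm_of_mem_zpowers hu hv)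
      (hcop hup hr hvr)
  have h3 : Nat.card G = (orderOf x * orderOf u) * (orderOf y * orderOf v) := by
    rw [← h.compl.card_mul_card, Nat.card_zpowers, Nat.card_zpowers, h1, h2]; ring
  have h4 : orderOf x * orderOf u = Nat.card (a • P : Sylow p G) := by
    apply Nat.dvd_antisymm
    · obtain ⟨k, hk⟩ := hxp
      obtain ⟨l, hl⟩ := hup
      obtain ⟨i, -, hi⟩ := (Nat.dvd_prime_pow hp.out).mp (orderOf_dvd_of_pow_eq_one hk)
      obtain ⟨j, -, hj⟩ := (Nat.dvd_prime_pow hp.out).mp (orderOf_dvd_of_pow_eq_one hl)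
      rw [hi, hj, ← pow_add]
      refine (a • P : Sylow p G).pow_dvd_card_of_pow_dvd_card ?_
      rw [pow_add, ← hi, ← hj, h3]
      exact dvd_mul_right _ _
    · have h5 : Nat.card (a • P : Sylow p G) ∣ Nat.card G := card_subgroup_dvd_card _
      rw [h3] at h5
      refine Nat.Coprime.dvd_of_dvd_mul_right ?_ h5
      rw [Sylow.card_eq_multiplicity]
      refine Nat.Coprime.pow_left _ (Nat.Coprime.mul_right ?_ ?_)
      · exact hq.coprime_dvd_right (orderOf_dvd_of_pow_eq_one hyq)
      · exact hr.coprime_dvd_right (orderOf_dvd_of_pow_eq_one hvr)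
  apply isComplement'_of_card_mul_and_disjoint
  · rw [Nat.card_zpowers, Nat.card_zpowers, Subgroup.orderOf_mk, Subgroup.orderOf_mk]
    exact h4
  · rw [disjoint_def]
    rintro z ⟨i, rfl⟩ ⟨j, hj⟩
    apply Subtype.ext
    have h5 : u ^ j = x ^ i := by simpa using congrArg Subtype.val hj
    have h6 : x ^ i = 1 := h.eq_one (zpow_mem hx i) (h5 ▸ zpow_mem hu j)
    simpa using h6

end

/-! ### Factorisations of `2`-groups -/

section

variable {G : Type u} [Group G] {σ φ : G}

theorem mem_of_pow_card_eq_one [Finite G] {B : Subgroup G} {x : G} (hB : B ≤ zpowers σ)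
    (hx : x ∈ zpowers σ) (h1 : x ^ Nat.card B = 1) : x ∈ B := by
  have : IsCyclic B := by
    have := (subgroupOfEquivOfLe hB)
    exact isCyclic_of_surjective this this.surjective
  obtain ⟨b, hb⟩ := IsCyclic.exists_zpow_surjective (G := B)
  have hbo : orderOf (b : G) = Nat.card B := by
    rw [Subgroup.orderOf_coe]
    exact orderOf_eq_card_of_forall_mem_zpowers hb
  exact zpowers_le.mpr b.2 (mem_zpowers_of_orderOf_dvd hx (hB b.2)
    (by rw [hbo]; exact orderOf_dvd_of_pow_eq_one h1))

theorem eq_one_of_orderOf_sq_zpow {H : Type*} [Group H] {z : H} (hz : IsPElement 2 z) {j : ℤ}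
    (hj : orderOf ((z ^ 2) ^ j) = orderOf z) : z = 1 := by
  obtain ⟨k, hk⟩ := hz
  obtain ⟨f, -, hf⟩ := (Nat.dvd_prime_pow Nat.prime_two).mp (orderOf_dvd_of_pow_eq_one hk)
  rcases Nat.eq_zero_or_pos f with rfl | hpos
  · rw [← orderOf_eq_one_iff, hf, pow_zero]
  · exfalso
    have h1 : ((z ^ 2) ^ j) ^ 2 ^ (f - 1) = 1 := by
      rw [← zpow_natCast, zpow_comm, zpow_natCast, ← pow_mul, ← pow_succ',
        Nat.sub_add_cancel hpos, ← hf, pow_orderOf_eq_one, one_zpow]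
    have h2 := orderOf_dvd_of_pow_eq_one h1
    rw [hj, hf] at h2
    have := (Nat.pow_dvd_pow_iff_le_right (by norm_num : 1 < 2)).mp h2
    omega

theorem defect_le_ker_of_mem_rad (h : IsCyclicFactorization σ φ) (hφ : φ ∈ rad σ φ) :
    defect σ φ ≤ ker σ := by
  have h1 : zpowers φ ≤ rad σ φ := zpowers_le.mpr hφ
  have h2 : cl σ φ ≤ rad σ φ := sup_le (normalClosure_le_normal h1) ker_le_rad
  exact fun x hx => h.mem_ker_of_mem_rad hx.1 (h2 hx.2)

/-- The values of the power function are odd. -/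
theorem mul_inv_mem_zpowers_sq (h : IsCyclicFactorization σ φ) (hG : IsPGroup 2 G)
    (hV : (defect σ φ ⊔ rad σ φ).Normal) (hne : ¬ defect σ φ ≤ ker σ) {s s' c : G}
    (hs : s ∈ zpowers σ) (hs' : s' ∈ zpowers σ) (hc : c ∈ zpowers φ) (e : φ * s = s' * c) :
    s⁻¹ * s' ∈ defect σ φ ∧ c * φ⁻¹ ∈ zpowers (φ ^ 2) := by
  have e1 : s⁻¹ * φ * s⁻¹⁻¹ = (s⁻¹ * s') * c := by
    rw [inv_inv, mul_assoc, e, mul_assoc]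
  have hx : s⁻¹ * s' ∈ defect σ φ := by
    refine mem_inf.mpr ⟨mul_mem (inv_mem hs) hs', ?_⟩
    have h1 := (inferInstance : (cl σ φ).Normal).conj_mem φ
      (zpowers_le_cl (mem_zpowers φ)) s⁻¹
    rw [e1] at h1
    simpa using mul_mem h1 (inv_mem (zpowers_le_cl (σ := σ) hc))
  refine ⟨hx, ?_⟩
  obtain ⟨i, rfl⟩ := hc
  simp only at e e1 ⊢
  rcases Int.even_or_odd' i with ⟨j, rfl | rfl⟩
  · exfalso
    set f := QuotientGroup.mk' (defect σ φ ⊔ rad σ φ)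
    have h1 : f (s⁻¹ * s') = 1 := (QuotientGroup.eq_one_iff _).mpr (mem_sup_left hx)
    have h2 := congrArg f e1
    rw [map_mul, map_mul, map_mul, map_inv f s⁻¹, h1, one_mul, zpow_mul, map_zpow] at h2
    have h3 : f φ = 1 := by
      apply eq_one_of_orderOf_sq_zpow (j := j)
      · obtain ⟨k, hk⟩ := hG φ
        exact ⟨k, by rw [← map_pow, hk, map_one]⟩
      · rw [← orderOf_conj_eq (f s⁻¹) (f φ), h2]
        congr 1
        simp
    have h4 : φ ∈ defect σ φ ⊔ rad σ φ := (QuotientGroup.eq_one_iff _).mp h3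
    obtain ⟨x, hx, d, hd, hdr, e2⟩ := exists_mul_of_mem_defect_sup_rad h4
    have h5 := (h.eq_and_eq (one_mem _) hx.1 (mem_zpowers φ) hd (by rw [one_mul]; exact e2)).2
    exact hne (h.defect_le_ker_of_mem_rad (h5 ▸ hdr))
  · refine ⟨j, ?_⟩
    simp only
    rw [zpow_add_one, mul_assoc, mul_inv_cancel, mul_one, zpow_mul]
    simp

variable [Finite G]

/-- A proper subgroup of a `2`-group has a proper normal closure. -/
theorem notMem_defect (h : IsCyclicFactorization σ φ) (hG : IsPGroup 2 G)
    (hne : ¬ defect σ φ ≤ ker σ) : σ ∉ defect σ φ := by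
  intro hσ
  have : Group.IsNilpotent G := hG.isNilpotent
  have hne' : ker σ ⊔ zpowers φ ≠ ⊤ := by
    intro htop
    apply hne
    have : σ ∈ ker σ := h.mem_ker_of_mem_sup (mem_zpowers σ) (htop ▸ mem_top σ)
    exact inf_le_left.trans (zpowers_le.mpr this)
  obtain ⟨M, hM, hle⟩ := (eq_top_or_exists_le_coatom _).resolve_left hne'
  have hMn : M.Normal := (Group.normalizerCondition_of_isNilpotent).normal_of_coatom M hM
  have hcl : cl σ φ ≤ M :=
    sup_le (normalClosure_le_normal fun c hc => hle (mem_sup_right hc)) (le_sup_left.trans hle)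
  refine hM.1 (eq_top_iff.mpr fun g _ => ?_)
  obtain ⟨a, ha, c, hc, rfl⟩ := h.exists_mul g
  exact mul_mem (zpowers_le.mpr (hcl hσ.2) ha) (hle (mem_sup_right hc))

theorem card_le_card_defect (h : IsCyclicFactorization σ φ) :
    Nat.card (zpowers φ) ≤ Nat.card (defect σ φ) := by
  have hmem : ∀ x : zpowers φ × zpowers φ, ∃ y : defect σ φ × zpowers φ,
      σ⁻¹ * ((x.1 : G) * σ * x.2) = (y.1 : G) * y.2 := by
    rintro ⟨⟨a, ha⟩, ⟨b, hb⟩⟩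
    have h1 : σ⁻¹ * (a * σ * b) ∈ cl σ φ := by
      have h2 := (inferInstance : (cl σ φ).Normal).conj_mem a (zpowers_le_cl ha) σ⁻¹
      have := mul_mem h2 (zpowers_le_cl (σ := σ) hb)
      simpa [mul_assoc] using this
    obtain ⟨x, hx, c, hc, e⟩ := h.exists_mul_of_mem_cl h1
    exact ⟨⟨⟨x, hx⟩, ⟨c, hc⟩⟩, e⟩
  choose F hF using hmem
  have hinj : Function.Injective F := by
    intro x y hxy
    apply h.mul_conj_injective
    have := (hF x).trans ((by rw [hxy]) : _ = _) |>.trans (hF y).symm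
    exact mul_left_cancel this
  have := Nat.card_le_card_of_injective F hinj
  rw [Nat.card_prod, Nat.card_prod] at this
  exact Nat.le_of_mul_le_mul_right this Nat.card_pos

theorem two_mul_card_le (h : IsCyclicFactorization σ φ) (hG : IsPGroup 2 G)
    (hV : (defect σ φ ⊔ rad σ φ).Normal) (hne : ¬ defect σ φ ≤ ker σ) (hφ : φ ≠ 1) :
    2 * Nat.card (zpowers σ) ≤ Nat.card (ker σ) * Nat.card (zpowers φ) := by
  have hsq : 2 * Nat.card (zpowers (φ ^ 2)) = Nat.card (zpowers φ) := by
    rw [Nat.card_zpowers, Nat.card_zpowers]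
    obtain ⟨k, hk⟩ := hG φ
    obtain ⟨f, -, hf⟩ := (Nat.dvd_prime_pow Nat.prime_two).mp (orderOf_dvd_of_pow_eq_one hk)
    have hf0 : f ≠ 0 := by
      rintro rfl
      exact hφ (orderOf_eq_one_iff.mp (by rw [hf, pow_zero]))
    have hd : 2 ∣ orderOf φ := by rw [hf]; exact dvd_pow_self 2 hf0
    rw [orderOf_pow_of_dvd (by norm_num) hd, Nat.mul_div_cancel' hd]
  choose f hf g hg e using h.exists_mul
  let F : zpowers σ → zpowers (φ ^ 2) := fun s =>
    ⟨g (φ * s) * φ⁻¹, (h.mul_inv_mem_zpowers_sq hG hV hne s.2 (hf _) (hg _) (e (φ * s))).2⟩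
  have hF : Function.Injective
      fun q : zpowers σ ⧸ (ker σ).subgroupOf (zpowers σ) => F q.out := by
    intro q r hqr
    have h1 : g (φ * q.out) = g (φ * r.out) := mul_right_cancel (congrArg Subtype.val hqr)
    have h2 := h.mul_inv_mem_normalCore q.out.2 (hf _) r.out.2 (hf _) (e _)
      (by rw [h1]; exact e (φ * r.out))
    rw [← QuotientGroup.out_eq' q, ← QuotientGroup.out_eq' r, eq_comm]
    apply QuotientGroup.eq.mpr
    rw [mem_subgroupOf]
    simp only [coe_mul, coe_inv]
    rwa [mul_comm_of_mem_zpowers (inv_mem r.out.2) q.out.2]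
  have h1 := Nat.card_le_card_of_injective _ hF
  have h2 := card_eq_card_quotient_mul_card_subgroup ((ker σ).subgroupOf (zpowers σ))
  have h3 : Nat.card ((ker σ).subgroupOf (zpowers σ)) = Nat.card (ker σ) :=
    Nat.card_congr (subgroupOfEquivOfLe (normalCore_le _)).toEquiv
  rw [h3] at h2
  rw [← hsq, h2]
  calc 2 * (Nat.card (zpowers σ ⧸ (ker σ).subgroupOf (zpowers σ)) * Nat.card (ker σ))
      ≤ 2 * (Nat.card (zpowers (φ ^ 2)) * Nat.card (ker σ)) := by gcongr
    _ = _ := by ring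

theorem two_mul_card_le_of_lt {B D : Subgroup G} (hle : B ≤ D) (hne : ¬ D ≤ B) :
    2 * Nat.card B ≤ Nat.card D := by
  obtain ⟨k, hk⟩ := card_dvd_of_le hle
  rcases k with _ | _ | k
  · exact absurd hk (by simpa using Nat.card_pos.ne')
  · exact absurd (eq_of_le_of_card_ge hle (by simp [hk])).ge hne
  · rw [hk, mul_comm 2]; exact Nat.mul_le_mul_left _ (by omega)

theorem cards_of_not_defect_le_ker (h : IsCyclicFactorization σ φ) (hG : IsPGroup 2 G)
    (hV : (defect σ φ ⊔ rad σ φ).Normal) (hne : ¬ defect σ φ ≤ ker σ)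
    (h32 : ¬ 32 ∣ Nat.card (zpowers σ)) :
    Nat.card (zpowers σ) = 16 ∧ Nat.card (zpowers φ) = 8 ∧ Nat.card (ker σ) = 4 ∧
      Nat.card (defect σ φ) = 8 := by
  have hφ : φ ≠ 1 := fun h1 => hne (h.defect_le_ker_of_mem_rad (by rw [h1]; exact one_mem _))
  have h1 := h.two_mul_card_le hG hV hne hφ
  have h2 := h.card_le_card_defect
  have h3 : 2 * Nat.card (defect σ φ) ≤ Nat.card (zpowers σ) :=
    two_mul_card_le_of_lt inf_le_left
      (fun hle => h.notMem_defect hG hne (hle (mem_zpowers σ)))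
  have h4 : 2 * Nat.card (ker σ) ≤ Nat.card (defect σ φ) :=
    two_mul_card_le_of_lt ker_le_defect hne
  obtain ⟨k, hk⟩ := hG σ
  obtain ⟨f, -, hf⟩ := (Nat.dvd_prime_pow Nat.prime_two).mp (orderOf_dvd_of_pow_eq_one hk)
  rw [← Nat.card_zpowers] at hf
  have hf4 : f ≤ 4 := by
    by_contra! hlt
    exact h32 (hf ▸ pow_dvd_pow 2 hlt)
  have hle : Nat.card (zpowers σ) ≤ 16 := by
    rw [hf]; exact Nat.pow_le_pow_right (by norm_num) hf4
  generalize Nat.card (zpowers σ) = a at *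
  generalize Nat.card (zpowers φ) = c at *
  generalize Nat.card (ker σ) = k at *
  generalize Nat.card (defect σ φ) = x at *
  have h5 : 4 * a ≤ k * a := by nlinarith
  have ha : 0 < a := by rw [hf]; positivity
  have h6 : 4 ≤ k := Nat.le_of_mul_le_mul_right h5 ha
  have ha' : a = 16 := by omega
  have hk' : k = 4 := by omega
  have hx' : x = 8 := by omega
  subst hk' ha' hx'
  omega

end

section

variable {G : Type u} [Group G] [Finite G] {σ φ : G}

theorem sq_mem_rad (h : IsCyclicFactorization σ φ) (hK : σ ^ 4 ∈ ker σ) (hσ : σ ∉ ker σ)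
    (hφ : φ ^ 8 = 1) : φ ^ 2 ∈ rad σ φ := by
  set f := QuotientGroup.mk' (rad σ φ)
  have h1 : f σ ≠ 1 := fun h1 =>
    hσ (h.mem_ker_of_mem_rad (mem_zpowers σ) ((QuotientGroup.eq_one_iff _).mp h1))
  have h2 := h.quotient.card_lt_card h1
  rw [Nat.card_zpowers, Nat.card_zpowers] at h2
  have h3 : orderOf (f σ) ≤ 4 := orderOf_le_of_pow_eq_one (by norm_num) (by
    rw [← map_pow]; exact (QuotientGroup.eq_one_iff _).mpr (ker_le_rad hK))
  have h4 : orderOf (f φ) ∣ 2 ^ 3 := orderOf_dvd_of_pow_eq_one (by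
    rw [← map_pow, show φ ^ 2 ^ 3 = 1 from hφ, map_one])
  obtain ⟨i, -, hi⟩ := (Nat.dvd_prime_pow Nat.prime_two).mp h4
  have hi1 : i ≤ 1 := by
    by_contra! hlt
    have := Nat.pow_le_pow_right (n := 2) (by norm_num) hlt
    change orderOf (f φ) < orderOf (f σ) at h2
    omega
  have h5 : orderOf (f φ) ∣ 2 := by rw [hi]; exact (pow_dvd_pow 2 hi1)
  apply (QuotientGroup.eq_one_iff _).mp
  change f (φ ^ 2) = 1
  rw [map_pow]
  exact orderOf_dvd_iff_pow_eq_one.mp h5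

/-- A factorisation of a `2`-group whose first factor has order at most `16` is smooth.  The
orders of the subgroups involved leave only the case `|⟨σ⟩| = 16`, `|⟨φ⟩| = 8`, `|ker σ| = 4`,
in which `φ σ φ⁻¹ = τ f` for a generator `τ` of `⟨σ⟩` and some `f ∈ ⟨φ ^ 2⟩`, and `φ ^ 2`
normalises `⟨σ⟩`.  Conjugating this relation by `φ ^ 2` shows that `φ ^ 4` centralises `σ`. -/
theorem defect_le_ker_of_isPGroup_two (h : IsCyclicFactorization σ φ) (hG : IsPGroup 2 G)
    (hV : (defect σ φ ⊔ rad σ φ).Normal) (h32 : ¬ 32 ∣ Nat.card (zpowers σ)) :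
    defect σ φ ≤ ker σ := by
  by_contra hne
  obtain ⟨hA, hC, hK, hX⟩ := h.cards_of_not_defect_le_ker hG hV hne h32
  have hσo : orderOf σ = 16 := by rw [← Nat.card_zpowers, hA]
  have hφo : orderOf φ = 8 := by rw [← Nat.card_zpowers, hC]
  have hφ8 : φ ^ 8 = 1 := by rw [← hφo, pow_orderOf_eq_one]
  have hφ4 : φ ^ 4 ≠ 1 := fun h4 => by
    have := orderOf_dvd_of_pow_eq_one h4
    rw [hφo] at this; omega
  have hKn : (ker σ).Normal := inferInstance
  have hKmem : ∀ x ∈ zpowers σ, x ^ 4 = 1 → x ∈ ker σ := fun x hx h4 =>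
    mem_of_pow_card_eq_one (normalCore_le _) hx (by rw [hK, h4])
  have hK4 : ∀ k ∈ ker σ, k ^ 4 = 1 := by
    intro k hk
    apply orderOf_dvd_iff_pow_eq_one.mp
    rw [← hK]; exact Subgroup.orderOf_dvd_natCard _ hk
  have hσ16 : σ ^ 16 = 1 := by rw [← hσo, pow_orderOf_eq_one]
  have hσ2K : σ ^ 2 ∉ ker σ := fun h2 => by
    have := orderOf_dvd_of_pow_eq_one (by rw [pow_mul]; exact hK4 _ h2 : σ ^ (2 * 4) = 1)
    rw [hσo] at this; omega
  have hσK : σ ∉ ker σ := fun h2 => hσ2K (pow_mem h2 2)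
  set g := φ ^ 2 with hg
  have hgC : g ∈ zpowers φ := pow_mem (mem_zpowers φ) 2
  have hg4 : g ^ 4 = 1 := by rw [hg, ← pow_mul]; exact hφ8
  have hgr : g ∈ rad σ φ := h.sq_mem_rad (hKmem _ (pow_mem (mem_zpowers σ) 4)
    (by rw [← pow_mul]; exact hσ16)) hσK hφ8
  have hφr : φ ∉ rad σ φ := fun h1 => hne (h.defect_le_ker_of_mem_rad h1)
  obtain ⟨τ, hτ, c, hc, e⟩ := h.exists_mul (φ * σ)
  obtain ⟨hστ, u, hu⟩ := h.mul_inv_mem_zpowers_sq hG hV hne (mem_zpowers σ) hτ hc e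
  simp only [← hg] at hu
  set f := c * φ⁻¹ with hf
  have hφσ : φ * σ * φ⁻¹ = τ * f := by rw [e, hf, mul_assoc]
  -- `τ` generates `⟨σ⟩`, as it differs from `σ` by an element of order at most `8`.
  have hτo : orderOf τ = 16 := by
    have h1 : τ ^ 16 = 1 := by
      apply orderOf_dvd_iff_pow_eq_one.mp
      rw [← hA]; exact Subgroup.orderOf_dvd_natCard _ hτ
    obtain ⟨i, hi, hi'⟩ := (Nat.dvd_prime_pow Nat.prime_two (m := 4)).mp
      (orderOf_dvd_of_pow_eq_one h1)
    have h2 : τ ^ 8 ≠ 1 := by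
      intro h8
      have h3 : (σ⁻¹ * τ) ^ 8 = 1 := by
        apply orderOf_dvd_iff_pow_eq_one.mp
        rw [← hX]; exact Subgroup.orderOf_dvd_natCard _ hστ
      have hcomm : Commute σ⁻¹ τ := mul_comm_of_mem_zpowers (inv_mem (mem_zpowers σ)) hτ
      rw [hcomm.mul_pow, h8, mul_one, inv_pow, inv_eq_one] at h3
      have := orderOf_dvd_of_pow_eq_one h3
      rw [hσo] at this; omega
    interval_cases i
    · exact absurd (orderOf_dvd_iff_pow_eq_one.mp (by rw [hi']; norm_num)) h2
    · exact absurd (orderOf_dvd_iff_pow_eq_one.mp (by rw [hi']; norm_num)) h2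
    · exact absurd (orderOf_dvd_iff_pow_eq_one.mp (by rw [hi']; norm_num)) h2
    · exact absurd (orderOf_dvd_iff_pow_eq_one.mp (by rw [hi']; norm_num)) h2
    · exact hi'
  have hτ16 : τ ^ 16 = 1 := by rw [← hτo, pow_orderOf_eq_one]
  obtain ⟨s, hs⟩ : σ ∈ zpowers τ :=
    mem_zpowers_of_orderOf_dvd (mem_zpowers σ) hτ (by rw [hσo, hτo])
  simp only at hs
  let m := QuotientGroup.mk' (ker σ)
  have hm : ∀ x, m x = 1 ↔ x ∈ ker σ := fun x => QuotientGroup.eq_one_iff x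
  -- `f ≡ ± g` modulo `ker σ` would make `φ` conjugate `σ ^ 2` into `⟨σ⟩`.
  have hno : m (τ⁻¹ * f * τ * f) ≠ 1 := by
    intro h1
    have h2 := (hm _).mp h1
    refine hσ2K (h.mem_normalCore_of_conj_mem (pow_mem (mem_zpowers σ) 2) ?_)
    have h3 : φ * σ ^ 2 * φ⁻¹ = τ ^ 2 * (τ⁻¹ * f * τ * f) := by
      rw [← conj_pow, hφσ, pow_two, pow_two]; group
    rw [h3]
    exact mul_mem (pow_mem hτ 2) (normalCore_le _ h2)
  have hconj_f : τ⁻¹ * f * τ = (τ⁻¹ * g * τ) ^ u := by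
    have := conj_zpow (i := u) (a := τ⁻¹) (b := g)
    rw [inv_inv] at this
    rw [this, hu]
  have hg4' : ∀ l : ℤ, g ^ (4 * l) = 1 := fun l => by
    rw [zpow_mul]; norm_cast; rw [hg4, one_zpow]
  -- `τ` centralises `g` modulo `ker σ`.
  have hgm : m (τ⁻¹ * g * τ) = m g := by
    have h1 : τ⁻¹ * g * τ ∈ rad σ φ := by
      simpa using (inferInstance : (rad σ φ).Normal).conj_mem g hgr τ⁻¹
    obtain ⟨k, hk, d, hd, hdr, e1⟩ := exists_mul_of_mem_rad h1
    obtain ⟨i, rfl⟩ := hd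
    simp only at hdr e1
    have hmk : m (τ⁻¹ * g * τ) = m (φ ^ i) := by
      rw [e1, map_mul, (hm k).mpr hk, one_mul]
    rcases Int.even_or_odd' i with ⟨j, rfl | rfl⟩
    · have h2 : m (τ⁻¹ * g * τ) = m (g ^ j) := by
        rw [hmk, hg, zpow_mul]; norm_cast
      rcases Int.even_or_odd' j with ⟨l, rfl | rfl⟩
      · exfalso
        have h3 : m (τ⁻¹ * g ^ 2 * τ) = 1 := by
          have : τ⁻¹ * g ^ 2 * τ = (τ⁻¹ * g * τ) ^ 2 := by rw [pow_two, pow_two]; group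
          rw [this, map_pow, h2, ← map_pow, ← zpow_natCast, ← zpow_mul]
          have : (2 * l * ((2 : ℕ) : ℤ)) = 4 * l := by push_cast; ring
          rw [this, hg4', map_one]
        have h4 := (hm _).mp h3
        have h5 : g ^ 2 ∈ ker σ := by
          have := hKn.conj_mem _ h4 τ
          have e2 : τ * (τ⁻¹ * g ^ 2 * τ) * τ⁻¹ = g ^ 2 := by group
          rwa [e2] at this
        have h6 := h.eq_one (normalCore_le _ h5) (pow_mem hgC 2)
        exact hφ4 (by rw [hg, ← pow_mul] at h6; exact h6)
      · rcases Int.even_or_odd' l with ⟨r, rfl | rfl⟩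
        · rw [h2]
          have : (2 * (2 * r) + 1) = 4 * r + 1 := by ring
          rw [this, zpow_add_one, hg4', one_mul]
        · exfalso
          have h3 : m (τ⁻¹ * g * τ) = m g⁻¹ := by
            rw [h2]
            have : (2 * (2 * r + 1) + 1) = 4 * (r + 1) + -1 := by ring
            rw [this, zpow_add, hg4', one_mul, zpow_neg_one]
          apply hno
          rw [hconj_f, map_mul, map_zpow, h3, ← hu, map_zpow, map_inv, inv_zpow,
            inv_mul_cancel]
    · exfalso
      apply hφr
      have : φ = φ ^ (2 * j + 1) * (g ^ j)⁻¹ := by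
        rw [zpow_add_one, zpow_mul, hg]
        have : Commute ((φ ^ (2 : ℤ)) ^ j) φ := ((Commute.refl φ).zpow_left _).zpow_left _
        rw [this.eq]; norm_cast; group
      have hmem := mul_mem hdr (inv_mem (zpow_mem hgr j))
      rwa [← this] at hmem
  have huodd : Odd u := by
    rw [← Int.not_even_iff_odd]
    rintro ⟨l, rfl⟩
    apply hno
    rw [hconj_f, map_mul, map_zpow, hgm, ← hu, ← map_zpow, ← map_mul, ← zpow_add]
    have : (l + l + (l + l)) = 4 * l := by ring
    rw [this, hg4', map_one]
  -- The action of `g` on `⟨σ⟩`.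
  set k := τ⁻¹ * g * τ * g⁻¹ with hk
  have hkK : k ∈ ker σ := by
    rw [← hm, hk, map_mul, hgm, ← map_mul, mul_inv_cancel, map_one]
  have hkA : k ∈ zpowers σ := normalCore_le _ hkK
  have hτk : Commute τ k := mul_comm_of_mem_zpowers hτ hkA
  have hgk' : τ⁻¹ * g * τ = k * g := by rw [hk]; group
  have hgτ : g * τ * g⁻¹ = τ * k := by rw [hk]; group
  have hτ4o : orderOf (τ ^ 4) = 4 := by
    rw [orderOf_pow_of_dvd (by norm_num) (by rw [hτo]; norm_num), hτo]
  obtain ⟨w, hw⟩ : k ∈ zpowers (τ ^ 4) := by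
    refine mem_zpowers_of_orderOf_dvd hkA (pow_mem hτ 4) ?_
    rw [hτ4o]; exact orderOf_dvd_of_pow_eq_one (hK4 k hkK)
  simp only at hw
  have hgτ4 : Commute g (τ ^ 4) := by
    change g * τ ^ 4 = τ ^ 4 * g
    rw [← mul_inv_eq_iff_eq_mul, ← conj_pow, hgτ, hτk.mul_pow, hK4 k hkK, mul_one]
  have hgk : Commute g k := by rw [← hw]; exact hgτ4.zpow_right w
  have hfk : Commute f k := by rw [← hu]; exact hgk.zpow_left u
  have hgf : Commute g f := by rw [← hu]; exact (Commute.refl g).zpow_right u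
  set k₁ := k ^ u with hk₁
  have hk₁4 : k₁ ^ 4 = 1 := hK4 _ (zpow_mem hkK u)
  have hτk₁ : Commute τ k₁ := hτk.zpow_right u
  have hfk₁ : Commute f k₁ := hfk.zpow_right u
  have hfτ : τ⁻¹ * f * τ = k₁ * f := by
    rw [hconj_f, hgk', hgk.symm.mul_zpow, hu]
  have hf4 : f ^ 4 = 1 := by
    rw [← hu, ← zpow_natCast, zpow_comm, zpow_natCast, hg4, one_zpow]
  have hfτ' : f * τ = τ * (k₁ * f) := by rw [← hfτ]; group
  have h4 : (τ * f) ^ 4 = τ ^ 4 * k₁ ^ 2 := by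
    have h2 : (τ * f) ^ 2 = τ ^ 2 * (k₁ * f ^ 2) := by
      calc (τ * f) ^ 2 = τ * (f * τ) * f := by rw [pow_two]; group
        _ = τ ^ 2 * (k₁ * f ^ 2) := by rw [hfτ', pow_two, pow_two]; group
    have h3 : Commute (f ^ 2) (τ ^ 2) := by
      have h5 : τ⁻¹ * (τ⁻¹ * f ^ 2 * τ) * τ = f ^ 2 := by
        have h6 : τ⁻¹ * f ^ 2 * τ = k₁ ^ 2 * f ^ 2 := by
          have := conj_pow (i := 2) (a := τ⁻¹) (b := f)
          rw [inv_inv] at this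
          rw [← this, hfτ, hfk₁.symm.mul_pow]
        have h7 : τ⁻¹ * (k₁ ^ 2 * f ^ 2) * τ = k₁ ^ 2 * (τ⁻¹ * f ^ 2 * τ) := by
          have : τ⁻¹ * k₁ ^ 2 = k₁ ^ 2 * τ⁻¹ := ((hτk₁.inv_left).pow_right 2).eq
          rw [← mul_assoc, this]; group
        rw [h6, h7, h6, ← mul_assoc, ← pow_add, hk₁4, one_mul]
      change f ^ 2 * τ ^ 2 = τ ^ 2 * f ^ 2
      calc f ^ 2 * τ ^ 2 = τ ^ 2 * (τ⁻¹ * (τ⁻¹ * f ^ 2 * τ) * τ) := by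
            rw [pow_two τ]; group
        _ = τ ^ 2 * f ^ 2 := by rw [h5]
    have h5 : Commute (τ ^ 2) (k₁ * f ^ 2) :=
      (hτk₁.pow_left 2).mul_right h3.symm
    have : (τ * f) ^ 4 = ((τ * f) ^ 2) ^ 2 := by rw [← pow_mul]
    rw [this, h2, h5.mul_pow, (hfk₁.symm.pow_right 2).mul_pow, ← pow_mul, ← pow_mul, hf4, mul_one]
  -- Conjugating `φ σ φ⁻¹ = τ f` by `g`.
  have hmain : k = (τ ^ 4 * k₁ ^ 2) ^ w := by
    have h5 : g * σ * g⁻¹ = σ * σ ^ (4 * w) := by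
      have h6 : k ^ s = σ ^ (4 * w) := by
        rw [← hw, ← hs, ← zpow_natCast, ← zpow_mul, ← zpow_mul, ← zpow_mul]
        congr 1; push_cast; ring
      rw [← h6]
      conv_lhs => rw [← hs, ← conj_zpow, hgτ, hτk.mul_zpow, hs]
    have h6 : Commute φ g := (Commute.refl φ).pow_right 2
    have h7 : g * (φ * σ * φ⁻¹) * g⁻¹ = φ * (g * σ * g⁻¹) * φ⁻¹ := by
      calc g * (φ * σ * φ⁻¹) * g⁻¹ = (g * φ) * σ * (g * φ)⁻¹ := by group
        _ = (φ * g) * σ * (φ * g)⁻¹ := by rw [h6.eq]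
        _ = _ := by group
    have h8 : φ * (σ * σ ^ (4 * w)) * φ⁻¹ = (τ * f) * ((τ * f) ^ 4) ^ w := by
      have : φ * (σ * σ ^ (4 * w)) * φ⁻¹ = (φ * σ * φ⁻¹) * (φ * σ * φ⁻¹) ^ (4 * w) := by
        rw [conj_zpow]; group
      rw [this, hφσ, zpow_mul]; norm_cast
    have h9 : g * (τ * f) * g⁻¹ = (τ * f) * k := by
      calc g * (τ * f) * g⁻¹ = (g * τ * g⁻¹) * (g * f * g⁻¹) := by group
        _ = τ * k * f := by rw [hgτ, hgf.eq]; group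
        _ = τ * f * k := by rw [mul_assoc τ k f, ← hfk.eq, ← mul_assoc τ f k]
    rw [hφσ, h5, h8, h9, h4] at h7
    exact mul_left_cancel h7
  have h5 : k₁ ^ (2 * w) = 1 := by
    have h6 : Commute (τ ^ 4) (k₁ ^ 2) := (hτk₁.pow_left 4).pow_right 2
    rw [h6.mul_zpow, hw] at hmain
    have := mul_eq_left.mp hmain.symm
    rw [zpow_mul]; exact_mod_cast this
  have h6 : τ ^ (8 * (w * w * u)) = 1 := by
    rw [← h5, hk₁, ← hw, ← zpow_natCast τ 4, ← zpow_mul, ← zpow_mul, ← zpow_mul]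
    congr 1; push_cast; ring
  have h7 : Even w := by
    have h8 := orderOf_dvd_iff_zpow_eq_one.mpr h6
    rw [hτo] at h8
    have h9 : (2 : ℤ) ∣ w * w * u := by
      have : (8 * 2 : ℤ) ∣ 8 * (w * w * u) := by exact_mod_cast h8
      exact (mul_dvd_mul_iff_left (by norm_num)).mp this
    have h10 : Even (w * w * u) := even_iff_two_dvd.mpr h9
    rcases Int.even_mul.mp h10 with h11 | h11
    · rcases Int.even_mul.mp h11 with h12 | h12 <;> exact h12
    · exact absurd h11 (Int.not_even_iff_odd.mpr huodd)
  obtain ⟨l, rfl⟩ := h7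
  have hk2 : k ^ 2 = 1 := by
    rw [← hw, ← zpow_natCast, ← zpow_natCast τ 4, ← zpow_mul, ← zpow_mul]
    have : (((4 : ℕ) : ℤ) * ((l + l) * ((2 : ℕ) : ℤ))) = (16 : ℕ) * l := by push_cast; ring
    rw [this, zpow_mul, zpow_natCast, hτ16, one_zpow]
  have hcomm : Commute τ (φ ^ 4) := by
    have h8 : τ⁻¹ * g ^ 2 * τ = g ^ 2 := by
      have := conj_pow (i := 2) (a := τ⁻¹) (b := g)
      rw [inv_inv] at this
      rw [← this, hgk', hgk.symm.mul_pow, hk2, one_mul]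
    have h9 : φ ^ 4 = g ^ 2 := by rw [hg, ← pow_mul]
    rw [h9]
    change τ * g ^ 2 = g ^ 2 * τ
    nth_rewrite 1 [← h8]
    group
  refine hφ4 (h.eq_one_of_conj_mem (pow_mem (mem_zpowers φ) 4) ?_)
  have h10 : Commute σ (φ ^ 4) := by rw [← hs]; exact hcomm.zpow_left s
  rw [h10.eq, mul_assoc, mul_inv_cancel, mul_one]
  exact pow_mem (mem_zpowers φ) 4

end

/-! ### Smoothness of cyclic factorisations -/

section

variable {G : Type u} [Group G] {σ φ : G} {p : ℕ}

theorem pow_eq_one_of_conj_eq_mul {b c z : G} {q : ℕ} (h : b * c * b⁻¹ = z * c)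
    (hbz : Commute b z) (hb : b ^ q = 1) : z ^ q = 1 := by
  have key : ∀ i : ℕ, b ^ i * c * (b ^ i)⁻¹ = z ^ i * c := by
    intro i
    induction i with
    | zero => simp
    | succ i ih =>
      calc b ^ (i + 1) * c * (b ^ (i + 1))⁻¹
          = b * (b ^ i * c * (b ^ i)⁻¹) * b⁻¹ := by rw [pow_succ']; group
        _ = (b * z ^ i) * c * b⁻¹ := by rw [ih]; group
        _ = z ^ i * (b * c * b⁻¹) := by rw [(hbz.pow_right i).eq]; group
        _ = z ^ (i + 1) * c := by rw [h, pow_succ]; group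
  have h1 := key q
  rw [hb, one_mul, inv_one, mul_one] at h1
  exact mul_eq_right.mp h1.symm

theorem mem_zpowers_of_isPElement {x b a : G} (hσ : σ = x * b) (hx : x ∈ zpowers σ)
    (hb : b ∈ zpowers σ) (hxp : IsPElement p x) {q : ℕ} (hq : p.Coprime q) (hbq : b ^ q = 1)
    (ha : a ∈ zpowers σ) (hap : IsPElement p a) : a ∈ zpowers x := by
  obtain ⟨i, rfl⟩ := ha
  simp only at hap ⊢
  have hxb : Commute x b := mul_comm_of_mem_zpowers hx hb
  have h1 : σ ^ i = x ^ i * b ^ i := by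
    conv_lhs => rw [hσ]
    exact hxb.mul_zpow i
  have h2 : IsPElement p (b ^ i) := by
    have : b ^ i = (x ^ i)⁻¹ * σ ^ i := by rw [h1]; group
    rw [this]
    refine IsPElement.mul ?_ (hxp.zpowers (inv_mem (zpow_mem (mem_zpowers x) i))) hap
    exact mul_comm_of_mem_zpowers (inv_mem (zpow_mem hx i)) (zpow_mem (mem_zpowers σ) i)
  obtain ⟨k, hk⟩ := h2
  have h3 : b ^ i = 1 := eq_one_of_pow_coprime (hq.pow_left k) hk
    (by rw [← zpow_natCast, zpow_comm, zpow_natCast, hbq, one_zpow])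
  rw [h1, h3, mul_one]
  exact zpow_mem (mem_zpowers x) i

theorem mem_rad_of_mem_defect_sup_rad (h : IsCyclicFactorization σ φ) {c : G}
    (hc : c ∈ zpowers φ) (hV : c ∈ defect σ φ ⊔ rad σ φ) : c ∈ rad σ φ := by
  obtain ⟨x, hx, d, hd, hdr, e⟩ := exists_mul_of_mem_defect_sup_rad hV
  rw [(h.eq_and_eq (one_mem _) hx.1 hc hd (by rw [one_mul]; exact e)).2]
  exact hdr

theorem commute_map_iff {N : Subgroup G} [N.Normal] {a b : G} :
    Commute (QuotientGroup.mk' N a) (QuotientGroup.mk' N b) ↔ a * b * a⁻¹ * b⁻¹ ∈ N := by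
  rw [← QuotientGroup.eq_one_iff]
  change _ ↔ QuotientGroup.mk' N (a * b * a⁻¹ * b⁻¹) = 1
  rw [map_mul, map_mul, map_mul, map_inv, map_inv, mul_inv_eq_one, mul_inv_eq_iff_eq_mul]
  rfl

theorem normal_inf_of_defect_le_ker (hle : defect σ φ ≤ ker σ) :
    (zpowers σ ⊓ normalClosure (zpowers φ : Set G)).Normal := by
  refine ⟨fun x hx g => ?_⟩
  have h1 : x ∈ ker σ := hle ⟨hx.1, mem_sup_left hx.2⟩
  exact ⟨h1 g, normalClosure_normal.conj_mem x hx.2 g⟩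

variable [Finite G]

theorem exists_pow_mem_ker {z : G} (hz : z ∈ defect σ φ) (hp : p.Prime)
    (hd : p ∣ orderOf (QuotientGroup.mk' (ker σ) z)) :
    ∃ y ∈ defect σ φ, y ∉ ker σ ∧ y ^ p ∈ ker σ := by
  set m := QuotientGroup.mk' (ker σ)
  obtain ⟨n, hn⟩ := hd
  have hpos : 0 < orderOf (m z) := orderOf_pos _
  have hn0 : 0 < n := by
    rcases Nat.eq_zero_or_pos n with rfl | h
    · simp [hn] at hpos
    · exact h
  refine ⟨z ^ n, pow_mem hz n, fun h1 => ?_, ?_⟩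
  · have h2 : m z ^ n = 1 := by rw [← map_pow]; exact (QuotientGroup.eq_one_iff _).mpr h1
    have h3 := Nat.le_of_dvd hn0 (orderOf_dvd_of_pow_eq_one h2)
    rw [hn] at h3
    have := hp.two_le
    nlinarith
  · apply (QuotientGroup.eq_one_iff _).mp
    change m ((z ^ n) ^ p) = 1
    rw [← pow_mul, mul_comm, ← hn, map_pow, pow_orderOf_eq_one]

/-- At odd primes there is no defect: this uses that `|⟨σ⟩|` is not divisible by the square of
an odd prime. -/
theorem exists_pow_two_pow_mem_ker (h : IsCyclicFactorization σ φ)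
    (hV : (defect σ φ ⊔ rad σ φ).Normal)
    (hodd : ∀ p : ℕ, p.Prime → p ≠ 2 → ¬ p ^ 2 ∣ Nat.card (zpowers σ)) {z : G}
    (hz : z ∈ defect σ φ) : ∃ k, z ^ 2 ^ k ∈ ker σ := by
  set m := QuotientGroup.mk' (ker σ)
  have h1 : ∀ {p : ℕ}, p.Prime → p ∣ orderOf (m z) → p = 2 := by
    intro p hp hd
    by_contra hp2
    obtain ⟨y, hy, hyK, hyp⟩ := exists_pow_mem_ker hz hp hd
    have : Fact p.Prime := ⟨hp⟩
    exact hodd p hp hp2 (h.exists_orderOf_eq_prime hV hy hyK hyp).1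
  have h2 := Nat.eq_prime_pow_of_unique_prime_dvd (orderOf_pos (m z)).ne' h1
  refine ⟨(orderOf (m z)).primeFactorsList.length, ?_⟩
  rw [← h2]
  apply (QuotientGroup.eq_one_iff _).mp
  change m (z ^ orderOf (m z)) = 1
  rw [map_pow, pow_orderOf_eq_one]

/-- If the `2`-part of `⟨σ⟩` normalises the `2`-part of `⟨φ⟩` modulo `ker σ`, then `ker σ · ⟨φ⟩`
is normal.  Indeed the defect is a `2`-group modulo the radical, so elements of odd order
act trivially on it and on the quotients it is involved in. -/
theorem defect_le_ker_of_conj_mem (h : IsCyclicFactorization σ φ)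
    (hV : (defect σ φ ⊔ rad σ φ).Normal)
    (hodd : ∀ p : ℕ, p.Prime → p ≠ 2 → ¬ p ^ 2 ∣ Nat.card (zpowers σ))
    {x b u v : G} {q r : ℕ} (hx : x ∈ zpowers σ) (hb : b ∈ zpowers σ)
    (hu : u ∈ zpowers φ) (hv : v ∈ zpowers φ) (hσ : σ = x * b) (hφ : φ = u * v)
    (hxp : IsPElement 2 x) (hup : IsPElement 2 u) (hq : Nat.Coprime 2 q)
    (hr : Nat.Coprime 2 r) (hbq : b ^ q = 1) (hvr : v ^ r = 1)
    (hconj : ∀ a ∈ zpowers x, a * u * a⁻¹ ∈ ker σ ⊔ zpowers φ) :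
    defect σ φ ≤ ker σ := by
  set f := QuotientGroup.mk' (rad σ φ) with hf
  have hfk : ∀ g, f g = 1 ↔ g ∈ rad σ φ := fun g => QuotientGroup.eq_one_iff g
  have hqo : Odd q := Nat.coprime_two_left.mp hq
  have hro : Odd r := Nat.coprime_two_left.mp hr
  have hz2 : ∀ z ∈ defect σ φ, IsPElement 2 (f z) := by
    intro z hz
    obtain ⟨k, hk⟩ := h.exists_pow_two_pow_mem_ker hV hodd hz
    exact ⟨k, by rw [← map_pow, hfk]; exact ker_le_rad hk⟩
  have hfeq : ∀ c ∈ zpowers φ, f c ∈ zpowers (f φ) := fun c hc => by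
    rw [← MonoidHom.map_zpowers]; exact mem_map_of_mem f hc
  have hfeqσ : ∀ a ∈ zpowers σ, f a ∈ zpowers (f σ) := fun c hc => by
    rw [← MonoidHom.map_zpowers]; exact mem_map_of_mem f hc
  have hV1 : ∀ z ∈ defect σ φ, ∀ g, z * (g * z⁻¹ * g⁻¹) ∈ defect σ φ ⊔ rad σ φ := fun z hz g =>
    mul_mem (mem_sup_left hz) (hV.conj_mem _ (mem_sup_left (inv_mem hz)) g)
  have hvz : ∀ z ∈ defect σ φ, Commute (f v) (f z) := by
    intro z hz
    obtain ⟨i, m, hm, e⟩ := exists_conj_eq_zpow_mul hV hz v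
    obtain ⟨k, hk⟩ := hz2 z hz
    refine commute_of_odd_of_conj_mem (k := k) (q := r) ⟨i, ?_⟩ hk ?_ hro
    · have := congrArg f e
      rw [map_mul, map_mul, map_inv, map_mul, (hfk m).mpr hm, mul_one, map_zpow] at this
      exact this.symm
    · rw [← map_pow, hvr, map_one]
  have huz : ∀ z ∈ defect σ φ, Commute (f u) (f z) := by
    intro z hz
    obtain ⟨a, ha, a', ha', e, hap, t, ht, hat⟩ := exists_primary_split 2 z
    have haD : a ∈ defect σ φ := zpowers_le.mpr hz ha
    have ha'D : a' ∈ defect σ φ := zpowers_le.mpr hz ha'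
    have hfa' : f a' = 1 := by
      obtain ⟨k, hk⟩ := h.exists_pow_two_pow_mem_ker hV hodd ha'D
      rw [hfk]
      exact ker_le_rad (mem_of_pow_coprime (ht.pow_left k) hk (by rw [hat]; exact one_mem _))
    rw [e, map_mul, hfa', mul_one]
    refine Commute.symm (commute_map_iff.mpr ?_)
    have hax := mem_zpowers_of_isPElement hσ hx hb hxp hq hbq haD.1 hap
    obtain ⟨k, hk, c, hc, e1⟩ := mem_sup_of_normal_left.mp (hconj a hax)
    have h1 : a * u * a⁻¹ * u⁻¹ = k * (c * u⁻¹) := by rw [← e1]; group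
    have h2 : a * u * a⁻¹ * u⁻¹ ∈ defect σ φ ⊔ rad σ φ := by
      have := hV1 a haD u
      have e2 : a * (u * a⁻¹ * u⁻¹) = a * u * a⁻¹ * u⁻¹ := by group
      rwa [e2] at this
    rw [h1] at h2 ⊢
    have h3 : c * u⁻¹ ∈ defect σ φ ⊔ rad σ φ := by
      have := mul_mem (inv_mem (mem_sup_left (ker_le_defect hk))) h2
      simpa using this
    exact mul_mem (ker_le_rad hk)
      (h.mem_rad_of_mem_defect_sup_rad (mul_mem hc (inv_mem hu)) h3)
  have hcz : ∀ z ∈ defect σ φ, ∀ c ∈ zpowers φ, Commute (f z) (f c) := by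
    rintro z hz c ⟨i, rfl⟩
    have h1 : Commute (f z) (f φ) := by
      have hfφ : f φ = f u * f v := by rw [← map_mul]; exact congrArg f hφ
      rw [hfφ]; exact (huz z hz).symm.mul_right (hvz z hz).symm
    simp only
    rw [map_zpow]
    exact h1.zpow_right i
  have hsplit : ∀ z ∈ defect σ φ, ∀ c ∈ zpowers φ, ∀ n : ℕ, f (z * c) ^ n = 1 →
      f z ^ n = 1 ∧ f c ^ n = 1 := by
    intro z hz c hc n hn
    rw [map_mul, (hcz z hz c hc).mul_pow] at hn
    exact h.quotient.eq_and_eq (pow_mem (hfeqσ z hz.1) n) (one_mem _)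
      (pow_mem (hfeq c hc) n) (one_mem _) (by rw [hn, one_mul])
  have hcl : ∀ g, ∀ c ∈ zpowers φ, g * c * g⁻¹ ∈ cl σ φ := fun g c hc =>
    (inferInstance : (cl σ φ).Normal).conj_mem c (zpowers_le_cl hc) g
  have hone : ∀ z ∈ defect σ φ, ∀ n, Nat.Coprime 2 n → f z ^ n = 1 → f z = 1 := by
    intro z hz n hn hz1
    obtain ⟨k, hk⟩ := hz2 z hz
    exact eq_one_of_pow_coprime (hn.pow_left k) hk hz1
  have hvσ : f (σ * v * σ⁻¹) ∈ zpowers (f φ) := by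
    obtain ⟨z, hz, c, hc, e⟩ := h.exists_mul_of_mem_cl (hcl σ v hv)
    have h1 : f (z * c) ^ r = 1 := by
      rw [← e, ← map_pow, conj_pow, hvr, mul_one, mul_inv_cancel, map_one]
    have h2 := hone z hz r hr (hsplit z hz c hc r h1).1
    rw [e, map_mul, h2, one_mul]
    exact hfeq c hc
  have hbu : f (b * u * b⁻¹) = f u := by
    obtain ⟨z, hz, c, hc, e⟩ := h.exists_mul_of_mem_cl (hcl b u hu)
    let f' := QuotientGroup.mk' (defect σ φ ⊔ rad σ φ)
    have hfk' : ∀ g, f' g = 1 ↔ g ∈ defect σ φ ⊔ rad σ φ := fun g => QuotientGroup.eq_one_iff g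
    have hfeq' : ∀ c ∈ zpowers φ, f' c ∈ zpowers (f' φ) := fun c hc => by
      rw [← MonoidHom.map_zpowers]; exact mem_map_of_mem f' hc
    have e1 : f' b * f' u * (f' b)⁻¹ = f' c := by
      rw [← map_inv, ← map_mul, ← map_mul, e, map_mul, (hfk' z).mpr (mem_sup_left hz), one_mul]
    have h1 : Commute (f' b) (f' u) := by
      obtain ⟨k, hk⟩ := hup
      refine commute_of_odd_of_conj_mem (k := k) (q := q)
        (conj_mem_zpowers (hfeq' u hu) (e1 ▸ hfeq' c hc)) ?_ ?_ hqo
      · rw [← map_pow, hk, map_one]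
      · rw [← map_pow, hbq, map_one]
    have h2 : f' (c * u⁻¹) = 1 := by
      rw [map_mul, ← e1, h1.eq, map_inv]; group
    have h3 := h.mem_rad_of_mem_defect_sup_rad (mul_mem hc (inv_mem hu)) ((hfk' _).mp h2)
    have h4 : f c = f u := by
      have := (hfk _).mpr h3
      rwa [map_mul, map_inv, mul_inv_eq_one] at this
    have h5 : f b * f u * (f b)⁻¹ = f z * f u := by
      rw [← map_inv, ← map_mul, ← map_mul, e, map_mul, h4]
    have hbz : Commute (f b) (f z) := by
      change f b * f z = f z * f b
      rw [← map_mul, ← map_mul, mul_comm_of_mem_zpowers hb hz.1]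
    have h6 := pow_eq_one_of_conj_eq_mul h5 hbz (q := q) (by rw [← map_pow, hbq, map_one])
    rw [e, map_mul, hone z hz q hq h6, one_mul, h4]
  have hback : ∀ g, f g ∈ zpowers (f φ) → g ∈ ker σ ⊔ zpowers φ := by
    intro g hg
    rw [← MonoidHom.map_zpowers] at hg
    obtain ⟨c, hc, e⟩ := hg
    have h1 : c⁻¹ * g ∈ rad σ φ := QuotientGroup.eq.mp e
    have := mul_mem (mem_sup_right (S := ker σ) hc) (normalCore_le _ h1)
    simpa using this
  have huσ : σ * u * σ⁻¹ ∈ ker σ ⊔ zpowers φ := by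
    have h1 : f (σ * u * σ⁻¹) = f (x * u * x⁻¹) := by
      have : σ * u * σ⁻¹ = x * (b * u * b⁻¹) * x⁻¹ := by rw [hσ]; group
      rw [this, map_mul, map_mul, hbu, ← map_mul, ← map_mul]
    have h2 : (x * u * x⁻¹)⁻¹ * (σ * u * σ⁻¹) ∈ rad σ φ := QuotientGroup.eq.mp h1.symm
    have := mul_mem (hconj x (mem_zpowers x)) (normalCore_le _ h2)
    rwa [mul_inv_cancel_left] at this
  have hσφ : σ * φ * σ⁻¹ ∈ ker σ ⊔ zpowers φ := by
    have : σ * φ * σ⁻¹ = (σ * u * σ⁻¹) * (σ * v * σ⁻¹) := by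
      conv_lhs => rw [hφ]
      group
    rw [this]
    exact mul_mem huσ (hback _ hvσ)
  have hN : (ker σ ⊔ zpowers φ).Normal := by
    refine h.normal_of_conj_mem ?_ ?_
    · intro w hw
      obtain ⟨k, hk, _, ⟨i, rfl⟩, rfl⟩ := mem_sup_of_normal_left.mp hw
      have : σ * (k * φ ^ i) * σ⁻¹ = (σ * k * σ⁻¹) * (σ * φ * σ⁻¹) ^ i := by
        rw [conj_zpow]; group
      simp only
      rw [this]
      exact mul_mem (mem_sup_left ((inferInstance : (ker σ).Normal).conj_mem k hk σ))
        (zpow_mem hσφ i)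
    · intro w hw
      have hφm : φ ∈ ker σ ⊔ zpowers φ := mem_sup_right (mem_zpowers φ)
      exact mul_mem (mul_mem hφm hw) (inv_mem hφm)
  refine h.defect_le_ker_of_mem_rad ?_
  exact (normal_le_normalCore.mpr le_rfl) (mem_sup_right (mem_zpowers φ))

end

section

variable {G : Type u} [Group G] [Finite G] {σ φ : G}

/-- The inductive step for groups that are not `2`-groups: smoothness is deduced from that of
the Sylow `2`-subgroup `⟨x⟩⟨u⟩`. -/
theorem defect_le_ker_of_sylow (h : IsCyclicFactorization σ φ)
    (hV : (defect σ φ ⊔ rad σ φ).Normal)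
    (hodd : ∀ p : ℕ, p.Prime → p ≠ 2 → ¬ p ^ 2 ∣ Nat.card (zpowers σ))
    {x b u v : G} {q r : ℕ} (hx : x ∈ zpowers σ) (hb : b ∈ zpowers σ)
    (hu : u ∈ zpowers φ) (hv : v ∈ zpowers φ) (hσ : σ = x * b) (hφ : φ = u * v)
    (hxp : IsPElement 2 x) (hup : IsPElement 2 u) (hq : Nat.Coprime 2 q)
    (hr : Nat.Coprime 2 r) (hbq : b ^ q = 1) (hvr : v ^ r = 1) {T : Subgroup G}
    (hxT : x ∈ T) (huT : u ∈ T)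
    (hcompl : IsComplement' (zpowers (⟨x, hxT⟩ : T)) (zpowers (⟨u, huT⟩ : T)))
    (hT : IsCyclicFactorization (⟨x, hxT⟩ : T) (⟨u, huT⟩ : T) →
      defect (⟨x, hxT⟩ : T) (⟨u, huT⟩ : T) ≤ ker (⟨x, hxT⟩ : T)) :
    defect σ φ ≤ ker σ := by
  have hz_coe : ∀ (y : G) (hy : y ∈ T) (w : T), w ∈ zpowers (⟨y, hy⟩ : T) ↔
      (w : G) ∈ zpowers y := by
    intro y hy w
    constructor
    · rintro ⟨i, rfl⟩; exact ⟨i, by simp⟩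
    · rintro ⟨i, hi⟩; exact ⟨i, Subtype.ext (by simpa using hi)⟩
  by_contra hne
  obtain ⟨z, hz, hzK⟩ := SetLike.not_le_iff_exists.mp hne
  set m := QuotientGroup.mk' (ker σ)
  have h2z : 2 ∣ orderOf (m z) := by
    obtain ⟨k, hk⟩ := h.exists_pow_two_pow_mem_ker hV hodd hz
    have h1 : m z ^ 2 ^ k = 1 := by rw [← map_pow]; exact (QuotientGroup.eq_one_iff _).mpr hk
    obtain ⟨f, -, hf⟩ := (Nat.dvd_prime_pow Nat.prime_two).mp (orderOf_dvd_of_pow_eq_one h1)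
    rw [hf]
    refine dvd_pow_self 2 ?_
    rintro rfl
    exact hzK ((QuotientGroup.eq_one_iff _).mp (orderOf_eq_one_iff.mp hf))
  obtain ⟨y, hy, hyK, hy2⟩ := exists_pow_mem_ker hz Nat.prime_two h2z
  obtain ⟨-, ε, hεC, hεr, hεo, hεconj, hYconj⟩ := h.exists_orderOf_eq_prime hV hy hyK hy2
  have hε1 : ε ≠ 1 := by rintro rfl; simp at hεo
  have hε2 : ε * ε = 1 := by rw [← pow_two, ← hεo, pow_orderOf_eq_one]
  have hKn : (ker σ).Normal := inferInstance
  have hrn : (rad σ φ).Normal := inferInstance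
  have hεmem : ∀ e ∈ zpowers ε, e = 1 ∨ e = ε := by
    rintro e ⟨i, rfl⟩
    rcases Int.even_or_odd' i with ⟨j, rfl | rfl⟩
    · left; simp only; rw [zpow_mul, zpow_two, hε2, one_zpow]
    · right; simp only; rw [zpow_add_one, zpow_mul, zpow_two, hε2, one_zpow, one_mul]
  have hεK : ε ∉ ker σ := fun h1 => hε1 (h.eq_one (normalCore_le _ h1) hεC)
  have hεconj' : ∀ g, ∃ k ∈ ker σ, IsPElement 2 k ∧ g * ε * g⁻¹ = k * ε := by
    intro g
    obtain ⟨k, hk, hkp, e, he, e1⟩ := hεconj g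
    rcases hεmem e he with rfl | rfl
    · exfalso
      rw [mul_one] at e1
      have h1 := hKn.conj_mem _ (e1 ▸ hk : g * ε * g⁻¹ ∈ ker σ) g⁻¹
      refine hεK ?_
      simpa [mul_assoc] using h1
    · exact ⟨k, hk, hkp, e1⟩
  -- The involution `ε` commutes with `b`, hence not with `x`; so `⟨u⟩` is core-free in `T`.
  have hbε : Commute b ε := by
    obtain ⟨k, hk, ⟨i, hi⟩, e1⟩ := hεconj' b
    have h1 := pow_eq_one_of_conj_eq_mul e1
      (mul_comm_of_mem_zpowers hb (normalCore_le _ hk)) hbq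
    have h2 : k = 1 := eq_one_of_pow_coprime (hq.pow_left i) hi h1
    rw [h2, one_mul] at e1
    exact mul_inv_eq_iff_eq_mul.mp e1
  have hxε : x * ε * x⁻¹ ∉ zpowers φ := by
    intro h1
    refine hε1 (h.eq_one_of_conj_mem hεC ?_)
    have : σ * ε * σ⁻¹ = x * (b * ε * b⁻¹) * x⁻¹ := by rw [hσ]; group
    rw [this, hbε.eq, mul_inv_cancel_right]
    exact h1
  have hfac : IsCyclicFactorization (⟨x, hxT⟩ : T) (⟨u, huT⟩ : T) := by
    refine ⟨hcompl, ?_⟩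
    rw [eq_bot_iff]
    rintro w hw
    by_contra hw1
    have hw1' : (w : G) ≠ 1 := fun h1 => hw1 (Subtype.ext h1)
    have hwu : (w : G) ∈ zpowers u := (hz_coe u huT w).mp (normalCore_le _ hw)
    have hεw : ε ∈ zpowers (w : G) := by
      refine mem_zpowers_of_orderOf_dvd hεC (zpowers_le.mpr hu hwu) ?_
      rw [hεo]
      obtain ⟨k, hk⟩ := hup.zpowers hwu
      obtain ⟨f, -, hf⟩ := (Nat.dvd_prime_pow Nat.prime_two).mp (orderOf_dvd_of_pow_eq_one hk)
      rw [hf]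
      refine dvd_pow_self 2 ?_
      rintro rfl
      exact hw1' (orderOf_eq_one_iff.mp hf)
    obtain ⟨i, hi⟩ := hεw
    have h1 := (inferInstance : (zpowers (⟨u, huT⟩ : T)).normalCore.Normal).conj_mem _
      (zpow_mem hw i) ⟨x, hxT⟩
    have h2 := (hz_coe u huT _).mp (normalCore_le _ h1)
    apply hxε
    rw [← hi]
    exact zpowers_le.mpr hu (by simpa using h2)
  have hsm := hT hfac
  by_cases hcase : ∀ w ∈ ker (⟨x, hxT⟩ : T), (w : G) ∈ ker σ
  · refine hne (h.defect_le_ker_of_conj_mem hV hodd hx hb hu hv hσ hφ hxp hup hq hr hbq hvr ?_)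
    intro a ha
    have haT : a ∈ T := zpowers_le.mpr hxT ha
    have h1 : (⟨a, haT⟩ : T) * ⟨u, huT⟩ * (⟨a, haT⟩ : T)⁻¹ ∈ cl (⟨x, hxT⟩ : T) ⟨u, huT⟩ :=
      (inferInstance : (cl (⟨x, hxT⟩ : T) ⟨u, huT⟩).Normal).conj_mem _
        (zpowers_le_cl (mem_zpowers _)) _
    obtain ⟨w, hw, c, hc, e⟩ := hfac.exists_mul_of_mem_cl h1
    have e' : a * u * a⁻¹ = (w : G) * c := by simpa using congrArg Subtype.val e
    rw [e']
    exact mul_mem (mem_sup_left (hcase w (hsm hw)))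
      (mem_sup_right (zpowers_le.mpr hu ((hz_coe u huT c).mp hc)))
  · -- Otherwise the `2`-part `a` of `y` generates a normal subgroup of `T`; it is then
    -- normalised by `u`, and also by `v`, and lies in `ker σ`.
    push Not at hcase
    obtain ⟨w, hw, hwK⟩ := hcase
    obtain ⟨a, ha, a', ha', e, hap, t, ht, hat⟩ := exists_primary_split 2 y
    have hyY : y ∈ zpowers y ⊔ ker σ := mem_sup_left (mem_zpowers y)
    have haY : a ∈ zpowers y ⊔ ker σ := zpowers_le.mpr hyY ha
    have haA : a ∈ zpowers σ := sup_ker_le hy.1 haY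
    have ha'K : a' ∈ ker σ := by
      refine mem_of_pow_coprime ht (pow_mem_ker_of_mem_sup hy.1 hy2
        (zpowers_le.mpr hyY ha')) ?_
      rw [hat]; exact one_mem _
    have haK : a ∉ ker σ := fun h1 => hyK (e ▸ mul_mem h1 ha'K)
    have ha2 : a ^ 2 ∈ ker σ := pow_mem_ker_of_mem_sup hy.1 hy2 haY
    have hwx : (w : G) ∈ zpowers x := (hz_coe x hxT w).mp (normalCore_le _ hw)
    have hwA : (w : G) ∈ zpowers σ := zpowers_le.mpr hx hwx
    have haw : a ∈ zpowers (w : G) := by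
      obtain ⟨k, hk⟩ := hap
      obtain ⟨l, hl⟩ := hxp.zpowers hwx
      obtain ⟨i, -, hi⟩ := (Nat.dvd_prime_pow Nat.prime_two).mp (orderOf_dvd_of_pow_eq_one hk)
      obtain ⟨j, -, hj⟩ := (Nat.dvd_prime_pow Nat.prime_two).mp (orderOf_dvd_of_pow_eq_one hl)
      refine mem_zpowers_of_orderOf_dvd haA hwA ?_
      rw [hi, hj]
      refine pow_dvd_pow 2 ?_
      by_contra! hlt
      -- a proper subgroup of `⟨a⟩` lies in `⟨a ^ 2⟩ ≤ ker σ`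
      apply hwK
      refine zpowers_le.mpr ha2 (mem_zpowers_of_orderOf_dvd hwA (pow_mem haA 2) ?_)
      rw [orderOf_pow_of_dvd (by norm_num) (by rw [hi]; exact dvd_pow_self 2 (by omega)), hi, hj]
      obtain ⟨i', rfl⟩ : ∃ i', i = i' + 1 := ⟨i - 1, by omega⟩
      rw [pow_succ, Nat.mul_div_cancel _ (by norm_num)]
      exact pow_dvd_pow 2 (by omega)
    have hua : u * a * u⁻¹ ∈ zpowers a := by
      obtain ⟨i, hi⟩ := haw
      have h1 := (inferInstance : (ker (⟨x, hxT⟩ : T)).Normal).conj_mem _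
        (zpow_mem hw i) ⟨u, huT⟩
      have h2 := (hz_coe x hxT _).mp (normalCore_le _ h1)
      refine conj_mem_zpowers haA (zpowers_le.mpr hx ?_)
      rw [← hi]
      simpa using h2
    have hYcases : ∀ w ∈ zpowers y ⊔ ker σ, w ∉ ker σ → a⁻¹ * w ∈ ker σ := by
      intro w hw hwK
      obtain ⟨_, ⟨i, rfl⟩, k, hk, rfl⟩ := mem_sup_of_normal_right.mp hw
      have hcomm : Commute y a := mul_comm_of_mem_zpowers hy.1 haA
      simp only at hwK ⊢
      rcases Int.even_or_odd' i with ⟨j, rfl | rfl⟩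
      · exfalso
        apply hwK
        rw [zpow_mul]
        exact mul_mem (zpow_mem (by exact_mod_cast hy2) j) hk
      · have h1 : y ^ (2 * j + 1) = a * (a' * (y ^ (2 : ℤ)) ^ j) := by
          rw [add_comm, zpow_add, zpow_one, zpow_mul, ← mul_assoc, ← e]
        rw [h1]
        have : a⁻¹ * (a * (a' * (y ^ (2 : ℤ)) ^ j) * k) = a' * (y ^ (2 : ℤ)) ^ j * k := by group
        rw [this]
        exact mul_mem (mul_mem ha'K (zpow_mem (by exact_mod_cast hy2) j)) hk
    have hvε : Commute v ε := mul_comm_of_mem_zpowers hv hεC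
    have hva : v * a * v⁻¹ ∈ zpowers σ := by
      obtain ⟨z', hz', -, e', he', e1⟩ := hYconj v a haY hap
      rcases hεmem e' he' with rfl | rfl
      · rw [e1, mul_one]; exact sup_ker_le hy.1 hz'
      have hz'K : z' ∉ ker σ := by
        intro h1
        have h2 : v * a * v⁻¹ ∈ rad σ φ := by rw [e1]; exact mul_mem (ker_le_rad h1) hεr
        have h3 := hrn.conj_mem _ h2 v⁻¹
        refine haK (h.mem_ker_of_mem_rad haA ?_)
        simpa [mul_assoc] using h3
      set k := a⁻¹ * z' with hk
      have hkK : k ∈ ker σ := hYcases z' hz' hz'K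
      set k' := v * k * v⁻¹ with hk'
      have hk'K : k' ∈ ker σ := hKn.conj_mem k hkK v
      have hsq : v ^ 2 * a * (v ^ 2)⁻¹ = z' * (e' * k' * e'⁻¹) := by
        calc v ^ 2 * a * (v ^ 2)⁻¹ = v * (v * a * v⁻¹) * v⁻¹ := by rw [pow_two]; group
          _ = (v * z' * v⁻¹) * (v * e' * v⁻¹) := by rw [e1]; group
          _ = (v * z' * v⁻¹) * e' := by rw [hvε.eq, mul_inv_cancel_right]
          _ = ((v * a * v⁻¹) * k') * e' := by rw [hk', hk]; group
          _ = z' * (e' * k' * e') := by rw [e1]; group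
          _ = z' * (e' * k' * e'⁻¹) := by rw [inv_eq_of_mul_eq_one_left hε2]
      have h4 : v ^ 2 * a * (v ^ 2)⁻¹ ∈ zpowers a := by
        refine conj_mem_zpowers haA ?_
        rw [hsq]
        exact mul_mem (sup_ker_le hy.1 hz') (normalCore_le _ (hKn.conj_mem k' hk'K e'))
      have h5 : ∀ w ∈ zpowers a, v ^ 2 * w * (v ^ 2)⁻¹ ∈ zpowers a := by
        rintro _ ⟨i, rfl⟩
        simp only
        rw [← conj_zpow]
        exact zpow_mem h4 i
      have h6 : v ∈ zpowers (v ^ 2) := by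
        refine mem_of_pow_coprime (Nat.Coprime.symm hr) ?_ (mem_zpowers (v ^ 2))
        rw [hvr]; exact one_mem _
      exact zpowers_le.mpr haA (conj_mem_of_mem_zpowers h5 h6 a (mem_zpowers a))
    refine haK (h.mem_normalCore_of_conj_mem haA ?_)
    obtain ⟨i, hi⟩ := hua
    have huv : u * v = v * u := mul_comm_of_mem_zpowers hu hv
    have h7 : φ * a * φ⁻¹ = (v * a * v⁻¹) ^ i := by
      rw [conj_zpow]
      simp only at hi
      rw [hi, hφ, huv]; group
    rw [h7]
    exact zpow_mem hva i

end

/-- A cyclic factorisation is smooth if the order of its first factor is neither divisible by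
`32` nor by the square of an odd prime. -/
theorem defect_le_ker {G : Type u} [Group G] [Finite G] {σ φ : G}
    (h : IsCyclicFactorization σ φ)
    (hodd : ∀ p : ℕ, p.Prime → p ≠ 2 → ¬ p ^ 2 ∣ Nat.card (zpowers σ))
    (h32 : ¬ 32 ∣ Nat.card (zpowers σ)) : defect σ φ ≤ ker σ := by
  induction hn : Nat.card G using Nat.strong_induction_on generalizing G with
  | _ n ih =>
  subst hn
  rcases eq_or_ne σ 1 with rfl | hσ1
  · intro x hx
    have : x = 1 := by simpa using hx.1
    rw [this]; exact one_mem _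
  have hV : (defect σ φ ⊔ rad σ φ).Normal := by
    have hlt : Nat.card (G ⧸ rad σ φ) < Nat.card G := by
      rw [card_eq_card_quotient_mul_card_subgroup (rad σ φ)]
      have h1 : 1 < Nat.card (rad σ φ) := by
        rw [one_lt_card_iff_ne_bot]
        intro hbot
        exact h.normalCore_ne_bot hσ1 (le_bot_iff.mp (hbot ▸ ker_le_rad))
      have : 0 < Nat.card (G ⧸ rad σ φ) := Nat.card_pos
      nlinarith
    have hdvd : Nat.card (zpowers (QuotientGroup.mk' (rad σ φ) σ)) ∣ Nat.card (zpowers σ) := by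
      rw [Nat.card_zpowers, Nat.card_zpowers]
      exact orderOf_map_dvd _ σ
    exact normal_defect_sup_rad (normal_inf_of_defect_le_ker (ih _ hlt h.quotient
      (fun p hp hp2 hd => hodd p hp hp2 (hd.trans hdvd)) (fun hd => h32 (hd.trans hdvd)) rfl))
  obtain ⟨x, hx, b, hb, hσ, hxp, q, hq, hbq⟩ := exists_primary_split 2 σ
  obtain ⟨u, hu, v, hv, hφ, hup, r, hr, hvr⟩ := exists_primary_split 2 φ
  obtain ⟨T, hxT, huT, hTp, hcompl⟩ :=
    h.exists_isPGroup_isComplement' 2 hx hb hu hv hσ hφ hxp hup hq hr hbq hvr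
  by_cases hTtop : T = ⊤
  · subst hTtop
    exact h.defect_le_ker_of_isPGroup_two (hTp.of_equiv topEquiv) hV h32
  · refine h.defect_le_ker_of_sylow hV hodd hx hb hu hv hσ hφ hxp hup hq hr hbq hvr hxT huT
      hcompl fun hT => ?_
    have hlt : Nat.card T < Nat.card G := by
      refine lt_of_le_of_ne (Nat.le_of_dvd Nat.card_pos (card_subgroup_dvd_card T)) fun he => ?_
      exact hTtop ((card_eq_iff_eq_top T).mp he)
    have hdvd : Nat.card (zpowers (⟨x, hxT⟩ : T)) ∣ Nat.card (zpowers σ) := by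
      rw [Nat.card_zpowers, Subgroup.orderOf_mk]
      exact Subgroup.orderOf_dvd_natCard _ hx
    exact ih _ hlt hT (fun p hp hp2 hd => hodd p hp hp2 (hd.trans hdvd))
      (fun hd => h32 (hd.trans hdvd)) rfl

end IsCyclicFactorization

/-! ### The group generated by a skew morphism and the translations -/

section

variable {A : Type*} [Group A] {φ : Equiv.Perm A} {pw : A → ℤ}

theorem IsPowerFunction.mul_toPermHom (h : IsPowerFunction φ pw) (a : A) :
    φ * MulAction.toPermHom A A a = MulAction.toPermHom A A (φ a) * φ ^ pw a := by
  ext b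
  exact h a b

theorem IsPowerFunction.exists_zpow_mul [Finite A] (h : IsPowerFunction φ pw) (i : ℤ) (a : A) :
    ∃ b, ∃ j : ℤ, φ ^ i * MulAction.toPermHom A A a = MulAction.toPermHom A A b * φ ^ j := by
  obtain ⟨n, hn⟩ := mem_powers_iff_mem_zpowers.mpr (zpow_mem (mem_zpowers φ) i)
  simp only at hn
  rw [← hn]
  clear hn
  induction n generalizing a with
  | zero => exact ⟨a, 0, by simp⟩
  | succ n ih =>
    obtain ⟨b, j, e⟩ := ih (φ a)
    exact ⟨b, j + pw a, by rw [pow_succ, mul_assoc, h.mul_toPermHom, ← mul_assoc, e, mul_assoc,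
      zpow_add]⟩

/-- The skew product group: the permutations of `A` of the form `L_a φ ^ i`, where `L_a` is the
translation by `a`. -/
def IsPowerFunction.skewProduct [Finite A] (h : IsPowerFunction φ pw) :
    Subgroup (Equiv.Perm A) where
  carrier := {g | ∃ a, ∃ i : ℤ, g = MulAction.toPermHom A A a * φ ^ i}
  one_mem' := ⟨1, 0, by rw [map_one, one_mul, zpow_zero]⟩
  mul_mem' := by
    rintro _ _ ⟨a, i, rfl⟩ ⟨b, j, rfl⟩
    obtain ⟨c, k, e⟩ := h.exists_zpow_mul i b
    refine ⟨a * c, k + j, ?_⟩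
    rw [map_mul, zpow_add, mul_assoc, ← mul_assoc (φ ^ i), e]
    simp only [mul_assoc]
  inv_mem' := by
    rintro _ ⟨a, i, rfl⟩
    obtain ⟨c, k, e⟩ := h.exists_zpow_mul (-i) a⁻¹
    exact ⟨c, k, by rw [mul_inv_rev, ← e, map_inv, zpow_neg]⟩

theorem IsPowerFunction.toPermHom_mem [Finite A] (h : IsPowerFunction φ pw) (a : A) :
    MulAction.toPermHom A A a ∈ h.skewProduct := ⟨a, 0, by simp⟩

theorem IsPowerFunction.self_mem [Finite A] (h : IsPowerFunction φ pw) :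
    φ ∈ h.skewProduct := ⟨1, 1, by rw [map_one, one_mul, zpow_one]⟩

theorem zpow_apply_one (h1 : φ 1 = 1) (i : ℤ) : (φ ^ i) 1 = 1 :=
  Equiv.Perm.zpow_apply_eq_self_of_apply_eq_self h1 i

theorem IsPowerFunction.isCyclicFactorization [Finite A] (h : IsPowerFunction φ pw)
    (h1 : φ 1 = 1) {s : A} (hs : ∀ a, a ∈ zpowers s) :
    IsCyclicFactorization (⟨_, h.toPermHom_mem s⟩ : h.skewProduct) ⟨φ, h.self_mem⟩ := by
  constructor
  · apply isComplement'_of_disjoint_and_mul_eq_univ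
    · rw [disjoint_def]
      rintro x ⟨i, rfl⟩ ⟨j, hj⟩
      have e : φ ^ j = MulAction.toPermHom A A (s ^ i) := by
        rw [map_zpow]; exact congrArg Subtype.val hj
      have e1 := Equiv.ext_iff.mp e 1
      rw [zpow_apply_one h1] at e1
      have e2 : s ^ i = 1 := by simpa using e1.symm
      apply Subtype.ext
      simp only [coe_zpow, coe_one]
      rw [← map_zpow, e2, map_one]
    · rw [Set.eq_univ_iff_forall]
      rintro ⟨_, a, i, rfl⟩
      obtain ⟨k, rfl⟩ := hs a
      refine Set.mem_mul.mpr ⟨_, zpow_mem (mem_zpowers _) k, _, zpow_mem (mem_zpowers _) i, ?_⟩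
      apply Subtype.ext
      simp [-MulAction.toPermHom_apply, map_zpow]
  · rw [eq_bot_iff]
    intro x hx
    rw [mem_bot]
    apply Subtype.ext
    ext a
    obtain ⟨i, hi⟩ := hx ⟨_, h.toPermHom_mem a⁻¹⟩
    have e : φ ^ i = MulAction.toPermHom A A a⁻¹ * x * (MulAction.toPermHom A A a⁻¹)⁻¹ :=
      congrArg Subtype.val hi
    have e1 := Equiv.ext_iff.mp e 1
    rw [zpow_apply_one h1, ← map_inv, inv_inv] at e1
    have e2 : (1 : A) = a⁻¹ * (x : Equiv.Perm A) (a * 1) := e1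
    rw [mul_one, eq_inv_mul_iff_mul_eq, mul_one] at e2
    exact e2.symm

/-- If the defect is contained in the kernel, then `φ` changes each `a` by an element of the
kernel, and the power function is constant on cosets of the kernel. -/
theorem IsPowerFunction.zpow_apply_eq_of_defect_le_ker [Finite A] (h : IsPowerFunction φ pw)
    (h1 : φ 1 = 1) {s : A} (hs : ∀ a, a ∈ zpowers s)
    (hle : IsCyclicFactorization.defect (⟨_, h.toPermHom_mem s⟩ : h.skewProduct)
      ⟨φ, h.self_mem⟩ ≤ IsCyclicFactorization.ker ⟨_, h.toPermHom_mem s⟩) (a : A) :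
    φ ^ pw (φ a) = φ ^ pw a := by
  let L := MulAction.toPermHom A A
  let t : A → h.skewProduct := fun a => ⟨L a, h.toPermHom_mem a⟩
  let f : h.skewProduct := ⟨φ, h.self_mem⟩
  have ht : ∀ a, t a ∈ zpowers (t s) := by
    intro a
    obtain ⟨k, rfl⟩ := hs a
    exact ⟨k, Subtype.ext (map_zpow L s k).symm⟩
  have hx : t (a⁻¹ * φ a) ∈ IsCyclicFactorization.defect (t s) f := by
    refine mem_inf.mpr ⟨ht _, ?_⟩
    have e : t (a⁻¹ * φ a) = (t a)⁻¹ * f * (t a)⁻¹⁻¹ * (f ^ pw a)⁻¹ := by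
      rw [eq_mul_inv_iff_mul_eq, inv_inv]
      apply Subtype.ext
      change L (a⁻¹ * φ a) * φ ^ pw a = (L a)⁻¹ * φ * L a
      rw [mul_assoc _ φ, h.mul_toPermHom, map_mul, map_inv]
      simp only [L, mul_assoc]
    rw [e]
    have hf : f ∈ zpowers f := mem_zpowers f
    exact mul_mem ((inferInstance : (IsCyclicFactorization.cl (t s) f).Normal).conj_mem f
      (IsCyclicFactorization.zpowers_le_cl hf) _)
      (inv_mem (IsCyclicFactorization.zpowers_le_cl (zpow_mem hf _)))
  obtain ⟨k, hk⟩ := hle hx (f ^ pw a)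
  have hk' : L (s ^ k) = φ ^ pw a * L (a⁻¹ * φ a) * (φ ^ pw a)⁻¹ := by
    rw [map_zpow]; exact congrArg Subtype.val hk
  have e1 : L (φ (φ a)) * φ ^ pw (φ a) = L (φ a * s ^ k) * φ ^ pw a := by
    calc L (φ (φ a)) * φ ^ pw (φ a) = φ * L (φ a) := (h.mul_toPermHom (φ a)).symm
      _ = φ * L a * L (a⁻¹ * φ a) := by rw [mul_assoc, ← map_mul, mul_inv_cancel_left]
      _ = L (φ a) * (φ ^ pw a * L (a⁻¹ * φ a) * (φ ^ pw a)⁻¹) * φ ^ pw a := by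
        have e := h.mul_toPermHom a
        simp only [L]
        rw [e]
        group
      _ = L (φ a * s ^ k) * φ ^ pw a := by rw [← hk', map_mul]
  have e2 : φ (φ a) = φ a * s ^ k := by
    have := Equiv.ext_iff.mp e1 1
    simp only [Equiv.Perm.mul_apply, zpow_apply_one h1] at this
    simpa [L] using this
  rw [e2] at e1
  exact mul_left_cancel e1

/-- Skew morphisms of a cyclic group whose order is neither divisible by `32` nor by the square
of an odd prime are smooth. -/
theorem IsSkewMorphism.isSmooth_of_isCyclic [Finite A] [IsCyclic A]
    (hodd : ∀ p : ℕ, p.Prime → p ≠ 2 → ¬ p ^ 2 ∣ Nat.card A) (h32 : ¬ 32 ∣ Nat.card A)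
    (hφ : IsSkewMorphism φ) : IsSmoothSkewMorphism φ := by
  refine ⟨hφ, fun pw h a => ?_⟩
  obtain ⟨s, hs⟩ := IsCyclic.exists_generator (α := A)
  have hcard : Nat.card (zpowers (⟨_, h.toPermHom_mem s⟩ : h.skewProduct)) = Nat.card A := by
    rw [Nat.card_zpowers, Subgroup.orderOf_mk, ← orderOf_eq_card_of_forall_mem_zpowers hs]
    exact orderOf_injective (MulAction.toPermHom A A) MulAction.toPerm_injective s
  rw [← zpow_eq_zpow_iff_modEq]
  refine h.zpow_apply_eq_of_defect_le_ker hφ.1 hs ?_ a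
  refine (h.isCyclicFactorization hφ.1 hs).defect_le_ker ?_ ?_
  · rwa [hcard]
  · rwa [hcard]

end

/-! ### Skew morphisms that are not smooth -/

theorem not_isSmoothSkewMorphism {A : Type*} [Group A] {φ : Equiv.Perm A} {pw : A → ℤ}
    (h : IsPowerFunction φ pw) {a b : A} (hab : (φ ^ pw (φ a)) b ≠ (φ ^ pw a) b) :
    ¬ IsSmoothSkewMorphism φ := fun hs =>
  hab (by rw [zpow_eq_zpow_iff_modEq.mpr (hs.2 pw h a)])

/-- If `h ^ 2 = 0` then `x ↦ -x + h (x + x ^ 2)` is a square root of the automorphism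
`x ↦ (1 - 2 h) x`, and it is a skew morphism with power function `x ↦ 1 + 2 x`.  As it reverses
the sign of `x` modulo `h`, it is not smooth unless `4 h = 0`. -/
theorem exists_not_smooth_of_mul_self_eq_zero {n : ℕ} [NeZero n] {h : ZMod n} (hh : h * h = 0)
    (h4 : 4 * h ≠ 0) : ∃ φ : Equiv.Perm (Multiplicative (ZMod n)),
      IsSkewMorphism φ ∧ ¬ IsSmoothSkewMorphism φ := by
  let f : ZMod n → ZMod n := fun x => -x + h * (x + x ^ 2)
  have hff : ∀ x, f (f x) = (1 - 2 * h) * x := by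
    intro x
    linear_combination (x ^ 2 * h + 2 * x * h * x ^ 2 + h * x ^ 4 - 2 * x ^ 2 - 2 * x ^ 3 +
      x + x ^ 2) * hh
  have hinj : Function.Injective f := by
    intro x y hxy
    have h1 : (1 - 2 * h) * x = (1 - 2 * h) * y := by rw [← hff, ← hff, hxy]
    linear_combination (1 + 2 * h) * h1 + 4 * (x - y) * hh
  let φ : Equiv.Perm (ZMod n) := Equiv.ofBijective f (Finite.injective_iff_bijective.mp hinj)
  have hpow : ∀ (k : ℕ) (y : ZMod n), (φ ^ (2 * k)) y = (1 - 2 * h * k) * y := by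
    intro k
    induction k with
    | zero => intro y; simp
    | succ k ih =>
      intro y
      have : 2 * (k + 1) = 2 * k + 2 := by ring
      rw [this, pow_add, Equiv.Perm.mul_apply, pow_two, Equiv.Perm.mul_apply, ih]
      change (1 - 2 * h * k) * f (f y) = _
      rw [hff]
      push_cast
      linear_combination 4 * k * y * hh
  have hpow1 : ∀ (k : ℕ) (y : ZMod n),
      (φ ^ ((1 + 2 * k : ℕ) : ℤ)) y = -y + 2 * h * k * y + h * (y + y ^ 2) := by
    intro k y
    rw [zpow_natCast, pow_add, pow_one, Equiv.Perm.mul_apply, hpow]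
    change f _ = _
    simp only [f]
    linear_combination (-2 * k * y - 4 * k * y ^ 2 + 4 * h * k ^ 2 * y ^ 2) * hh
  let ψ : Equiv.Perm (Multiplicative (ZMod n)) := φ
  let pw : Multiplicative (ZMod n) → ℤ := fun x => ((1 + 2 * (Multiplicative.toAdd x).val : ℕ) : ℤ)
  have hpw : IsPowerFunction ψ pw := by
    intro x y
    change f (x.toAdd + y.toAdd) = f x.toAdd + (φ ^ pw x) y.toAdd
    rw [hpow1, ZMod.natCast_zmod_val]
    simp only [f]
    ring
  refine ⟨ψ, ⟨?_, pw, hpw⟩, not_isSmoothSkewMorphism hpw (a := Multiplicative.ofAdd 1)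
    (b := Multiplicative.ofAdd 1) ?_⟩
  · change f 0 = 0
    simp [f]
  · change (φ ^ ((1 + 2 * (f 1).val : ℕ) : ℤ)) 1 ≠ (φ ^ ((1 + 2 * (1 : ZMod n).val : ℕ) : ℤ)) 1
    rw [hpow1, hpow1, ZMod.natCast_zmod_val, ZMod.natCast_zmod_val]
    intro e
    apply h4
    simp only [f] at e
    linear_combination -e + 4 * hh

theorem exists_not_smooth_of_prod {A B C : Type*} [Group A] [Group B] [Group C]
    (e : A × B ≃* C) (hA : ∃ φ : Equiv.Perm A, IsSkewMorphism φ ∧ ¬ IsSmoothSkewMorphism φ) :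
    ∃ φ : Equiv.Perm C, IsSkewMorphism φ ∧ ¬ IsSmoothSkewMorphism φ := by
  obtain ⟨φ, hφ, hns⟩ := hA
  let F : Equiv.Perm A →* Equiv.Perm C :=
    { toFun := fun α => e.toEquiv.permCongr (α.prodCongr (Equiv.refl B))
      map_one' := by ext; simp
      map_mul' := by intro α β; ext; simp [Prod.map] }
  have hF : ∀ (α : Equiv.Perm A) (a : A) (b : B), F α (e (a, b)) = e (α a, b) := by
    intro α a b
    simp [F]
  have hpw : ∀ pw, IsPowerFunction φ pw →
      IsPowerFunction (F φ) (fun c => pw (e.symm c).1) := by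
    intro pw h c d
    obtain ⟨⟨a, b⟩, rfl⟩ := e.surjective c
    obtain ⟨⟨a', b'⟩, rfl⟩ := e.surjective d
    rw [← map_mul, Prod.mk_mul_mk, hF, hF, ← map_zpow, hF, ← map_mul, Prod.mk_mul_mk, h]
    simp
  have hsk : IsSkewMorphism (F φ) := by
    refine ⟨?_, ?_⟩
    · rw [← map_one e, Prod.one_eq_mk, hF, hφ.1]
    · obtain ⟨pw, h⟩ := hφ.2
      exact ⟨_, hpw pw h⟩
  refine ⟨F φ, hsk, fun hs => hns ⟨hφ, fun pw h a => ?_⟩⟩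
  have h1 := zpow_eq_zpow_iff_modEq.mpr (hs.2 _ (hpw pw h) (e (a, 1)))
  rw [← zpow_eq_zpow_iff_modEq]
  ext a'
  have h2 := Equiv.ext_iff.mp h1 (e (a', 1))
  rw [← map_zpow, ← map_zpow, hF, hF, hF] at h2
  simpa using h2

/-- A skew morphism of order `8` of the cyclic group of order `32`, with power function
`x ↦ 1 + 2 x` modulo `8`.  It satisfies `φ(x + 4) = φ(x) + 12` and acts as `-1` modulo `4`. -/
def skewFun32 (x : Fin 32) : Fin 32 :=
  3 * x + if x % 4 = 1 then 4 else if x % 4 = 3 then 20 else 0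

theorem exists_not_smooth_zmod_thirtyTwo : ∃ φ : Equiv.Perm (Multiplicative (ZMod 32)),
    IsSkewMorphism φ ∧ ¬ IsSmoothSkewMorphism φ := by
  have hinj : Function.Injective skewFun32 := by
    have : ∀ x y, skewFun32 x = skewFun32 y → x = y := by decide +kernel
    exact fun x y => this x y
  let φ : Equiv.Perm (Fin 32) :=
    Equiv.ofBijective skewFun32 (Finite.injective_iff_bijective.mp hinj)
  have hit : ∀ k : ℕ, ⇑(φ ^ (k : ℤ)) = skewFun32^[k] := by
    intro k
    rw [zpow_natCast, ← Equiv.Perm.iterate_eq_pow]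
    rfl
  have key : ∀ x y : Fin 32,
      skewFun32 (x + y) = skewFun32 x + skewFun32^[1 + 2 * (x.val % 4)] y := by decide +kernel
  have hne : skewFun32^[1 + 2 * ((skewFun32 1).val % 4)] 1 ≠
      skewFun32^[1 + 2 * ((1 : Fin 32).val % 4)] 1 := by decide +kernel
  let ψ : Equiv.Perm (Multiplicative (ZMod 32)) := φ
  let pw : Multiplicative (ZMod 32) → ℤ := fun x =>
    ((1 + 2 * ((Multiplicative.toAdd x : Fin 32).val % 4) : ℕ) : ℤ)
  have hpw : IsPowerFunction ψ pw := by
    intro x y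
    change skewFun32 ((x.toAdd : Fin 32) + (y.toAdd : Fin 32)) =
      skewFun32 x.toAdd + (φ ^ pw x) y.toAdd
    rw [hit]
    exact key _ _
  refine ⟨ψ, ⟨?_, pw, hpw⟩, not_isSmoothSkewMorphism hpw
    (a := Multiplicative.ofAdd (1 : ZMod 32)) (b := Multiplicative.ofAdd (1 : ZMod 32)) ?_⟩
  · change skewFun32 0 = 0
    decide
  · change (φ ^ ((1 + 2 * ((skewFun32 1).val % 4) : ℕ) : ℤ)) 1 ≠
      (φ ^ ((1 + 2 * ((1 : Fin 32).val % 4) : ℕ) : ℤ)) 1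
    rw [hit, hit]
    exact hne

theorem exists_not_smooth_of_sq_dvd {n p : ℕ} (hn : 0 < n) (hp : p.Prime) (hp2 : p ≠ 2)
    (hd : p ^ 2 ∣ n) : ∃ φ : Equiv.Perm (Multiplicative (ZMod n)),
      IsSkewMorphism φ ∧ ¬ IsSmoothSkewMorphism φ := by
  have : NeZero n := ⟨hn.ne'⟩
  obtain ⟨m, rfl⟩ := hd
  have hm : 0 < m := Nat.pos_of_mul_pos_left hn
  apply exists_not_smooth_of_mul_self_eq_zero (h := ((p * m : ℕ) : ZMod (p ^ 2 * m)))
  · rw [← Nat.cast_mul, ZMod.natCast_eq_zero_iff]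
    exact ⟨m, by ring⟩
  · have e : (4 : ZMod (p ^ 2 * m)) * ((p * m : ℕ) : ZMod (p ^ 2 * m)) =
        ((4 * (p * m) : ℕ) : ZMod (p ^ 2 * m)) := by push_cast; ring
    rw [e, Ne, ZMod.natCast_eq_zero_iff]
    intro hdvd
    have h1 : (p * m) * p ∣ (p * m) * 4 := by convert hdvd using 1 <;> ring
    have h2 : p ∣ 2 ^ 2 := (mul_dvd_mul_iff_left (mul_pos hp.pos hm).ne').mp h1
    exact hp2 ((Nat.prime_dvd_prime_iff_eq hp Nat.prime_two).mp (hp.dvd_of_dvd_pow h2))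

theorem exists_not_smooth_of_thirtyTwo_dvd {n : ℕ} (hn : 0 < n) (hd : 32 ∣ n) :
    ∃ φ : Equiv.Perm (Multiplicative (ZMod n)),
      IsSkewMorphism φ ∧ ¬ IsSmoothSkewMorphism φ := by
  have : NeZero n := ⟨hn.ne'⟩
  obtain ⟨m, rfl⟩ := hd
  rcases Nat.even_or_odd m with hm | hm
  · obtain ⟨l, rfl⟩ := hm
    have hl : 0 < l := by omega
    apply exists_not_smooth_of_mul_self_eq_zero (h := ((8 * l : ℕ) : ZMod (32 * (l + l))))
    · rw [← Nat.cast_mul, ZMod.natCast_eq_zero_iff]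
      exact ⟨l, by ring⟩
    · have e : (4 : ZMod (32 * (l + l))) * ((8 * l : ℕ) : ZMod (32 * (l + l))) =
          ((4 * (8 * l) : ℕ) : ZMod (32 * (l + l))) := by push_cast; ring
      rw [e, Ne, ZMod.natCast_eq_zero_iff]
      intro hdvd
      have := Nat.le_of_dvd (by omega) hdvd
      omega
  · -- `ℤ/32m` is a product, and the skew morphism of `ℤ/32` extends by the identity.
    have hc : Nat.Coprime 32 m := (Nat.coprime_two_left.mpr hm).pow_left 5
    have e : Multiplicative (ZMod 32) × Multiplicative (ZMod m) ≃*
        Multiplicative (ZMod (32 * m)) :=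
      (MulEquiv.prodMultiplicative (ZMod 32) (ZMod m)).symm.trans
        (AddEquiv.toMultiplicative (ZMod.chineseRemainder hc).symm.toAddEquiv)
    exact exists_not_smooth_of_prod e exists_not_smooth_zmod_thirtyTwo

theorem theorem1 (n : ℕ) (hn : 0 < n) :
    (∀ φ : Equiv.Perm (Multiplicative (ZMod n)), IsSkewMorphism φ → IsSmoothSkewMorphism φ) ↔
      ∃ e n₁ : ℕ, e ≤ 4 ∧ Odd n₁ ∧ Squarefree n₁ ∧ n = 2 ^ e * n₁ := by
  have : NeZero n := ⟨hn.ne'⟩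
  constructor
  · intro hall
    have hodd : ∀ p : ℕ, p.Prime → p ≠ 2 → ¬ p ^ 2 ∣ n := fun p hp hp2 hd => by
      obtain ⟨φ, h1, h2⟩ := exists_not_smooth_of_sq_dvd hn hp hp2 hd
      exact h2 (hall φ h1)
    have h32 : ¬ 32 ∣ n := fun hd => by
      obtain ⟨φ, h1, h2⟩ := exists_not_smooth_of_thirtyTwo_dvd hn hd
      exact h2 (hall φ h1)
    obtain ⟨e, n₁, hn₁, rfl⟩ := Nat.exists_eq_two_pow_mul_odd hn.ne'
    refine ⟨e, n₁, ?_, hn₁, ?_, rfl⟩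
    · by_contra! hlt
      exact h32 ((pow_dvd_pow 2 hlt).trans (dvd_mul_right _ _))
    · rw [Nat.squarefree_iff_prime_squarefree]
      intro p hp hd
      refine hodd p hp ?_ ((pow_two p ▸ hd).trans (dvd_mul_left _ _))
      rintro rfl
      exact Nat.not_even_iff_odd.mpr hn₁ (even_iff_two_dvd.mpr ((dvd_mul_right 2 2).trans hd))
  · rintro ⟨e, n₁, he, hn₁, hsq, rfl⟩ φ hφ
    have hcard : Nat.card (Multiplicative (ZMod (2 ^ e * n₁))) = 2 ^ e * n₁ := by
      rw [Nat.card_congr Multiplicative.toAdd, Nat.card_zmod]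
    refine hφ.isSmooth_of_isCyclic ?_ ?_
    · rw [hcard]
      intro p hp hp2 hd
      have hc : Nat.Coprime (p ^ 2) (2 ^ e) :=
        Nat.Coprime.pow _ _ ((Nat.coprime_primes hp Nat.prime_two).mpr hp2)
      have := hc.dvd_of_dvd_mul_left hd
      exact Nat.squarefree_iff_prime_squarefree.mp hsq p hp (pow_two p ▸ this)
    · rw [hcard]
      intro hd
      have hc : Nat.Coprime (2 ^ 5) n₁ := (Nat.coprime_two_left.mpr hn₁).pow_left 5
      have h1 : 2 ^ 5 ∣ 2 ^ e := hc.dvd_of_dvd_mul_right hd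
      have := (Nat.pow_dvd_pow_iff_le_right (by norm_num : 1 < 2)).mp h1
      omega
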